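/- Let $\hat e_1=(1,0)$, $\hat e_2=\tfrac12(1,\sqrt3)$, $\hat e_3=\tfrac12(-1,\sqrt3)$, and let $\mathcal L=\mathbb Z\hat e_1+\mathbb Z\hat e_2$ be the triangular lattice, with sublattices $\mathcal L^1=\mathbb Z(\hat e_1+\hat e_2)+\mathbb Z(\hat e_2+\hat e_3)$, $\mathcal L^2=\mathcal L^1+\hat e_1$, $\mathcal L^3=\mathcal L^1+\hat e_2$. For $\varepsilon>0$ let $\mathcal T_\varepsilon$ be the family of closed triangles $T=\mathrm{conv}\{\varepsilon i,\varepsilon j,\varepsilon k\}$ with $i,j,k\in\mathcal L$ and $|i-j|=|j-k|=|k-i|=1$; the vertices are always labelled so that $i\in\mathcal L^1$, $j\in\mathcal L^2$, $k\in\mathcal L^3$. For a spin field $u\colon\varepsilon\mathcal L\to\mathbb S^1$ and $T\in\mathcal T_\varepsilon$ put $$F_\varepsilon(u,T)=\varepsilon\,|u(\varepsilon i)+u(\varepsilon j)+u(\varepsilon k)|^2,\qquad \chi(u,T)=\frac{2}{3\sqrt3}\big(u(\varepsilon i)\times u(\varepsilon j)+u(\varepsilon j)\times u(\varepsilon k)+u(\varepsilon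 k)\times u(\varepsilon i)\big),$$ where $v\times w=v_1w_2-v_2w_1$. Let $\Omega\subset\mathbb R^2$ be open and bounded, let $F_\varepsilon(u)=\sum_{T\in\mathcal T_\varepsilon,\,T\subset\Omega}F_\varepsilon(u,T)$, and let $\chi(u)$ be the (almost everywhere defined) function on $\Omega$ with $\chi(u)=\chi(u,T)$ on $\Omega\cap\mathrm{int}\,T$ for every $T\in\mathcal T_\varepsilon$. Let $\varepsilon_n>0$ with $\varepsilon_n\to0$, and let $u_n\colon\varepsilon_n\mathcal L\to\mathbb S^1$ be spin fields with $\sup_n F_{\varepsilon_n}(u_n)<+\infty$. Then $\chi(u_n)\in L^1(\Omega)$ for every $n$, and there exist $\chi\in BV(\Omega;\{-1,1\})$ (that is, $\chi\in L^1(\Omega)$ has finite total variation in $\Omega$ and takes values in $\{-1,1\}$ almost everywhere) and a subsequence along which $\chi(u_n)\to\chi$ in $L^1(\Omega)$. -/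

import Mathlib

open MeasureTheory Filter Topology
open scoped ENNReal Pointwise

noncomputable section

namespace TriXY

/-- The Euclidean plane. -/
abbrev Plane := EuclideanSpace ℝ (Fin 2)

def e1 : Plane := !₂[1, 0]

def e2 : Plane := !₂[1 / 2, √3 / 2]

def e3 : Plane := !₂[-1 / 2, √3 / 2]

/-- The triangular lattice `ℒ`. -/
def lattice : Set Plane := {x | ∃ z₁ z₂ : ℤ, x = (z₁ : ℝ) • e1 + (z₂ : ℝ) • e2}

/-- The sublattice `ℒ¹`. -/
def sublattice1 : Set Plane :=
  {x | ∃ z₁ z₂ : ℤ, x = (z₁ : ℝ) • (e1 + e2) + (z₂ : ℝ) • (e2 + e3)}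

/-- The sublattice `ℒ² = ℒ¹ + ê₁`. -/
def sublattice2 : Set Plane := {x | ∃ y ∈ sublattice1, x = y + e1}

/-- The sublattice `ℒ³ = ℒ¹ + ê₂`. -/
def sublattice3 : Set Plane := {x | ∃ y ∈ sublattice1, x = y + e2}

/-- The triangles of the lattice `ℒ`. Two lattice points at distance one never lie in the same
sublattice, so the three vertices of a lattice triangle lie in the three different sublattices;
a triangle is recorded by its vertices `i ∈ ℒ¹`, `j ∈ ℒ²`, `k ∈ ℒ³`, in exactly one way. -/
structure Triangle where
  i : Plane
  j : Plane
  k : Plane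
  i_mem : i ∈ lattice
  j_mem : j ∈ lattice
  k_mem : k ∈ lattice
  i_mem1 : i ∈ sublattice1
  j_mem2 : j ∈ sublattice2
  k_mem3 : k ∈ sublattice3
  dist_ij : ‖i - j‖ = 1
  dist_jk : ‖j - k‖ = 1
  dist_ki : ‖k - i‖ = 1

/-- The rescaled closed triangle `conv {ε i, ε j, ε k}`. -/
def Triangle.carrier (T : Triangle) (ε : ℝ) : Set Plane :=
  convexHull ℝ {ε • T.i, ε • T.j, ε • T.k}

/-- Spin fields `u : ε ℒ → 𝕊¹`. -/
abbrev SpinField (ε : ℝ) := (ε • lattice : Set Plane) → Metric.sphere (0 : Plane) 1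

/-- The three spins of `u` at the vertices `ε i`, `ε j`, `ε k` of a triangle. -/
def spinI {ε : ℝ} (u : SpinField ε) (T : Triangle) : Plane :=
  u ⟨ε • T.i, Set.smul_mem_smul_set T.i_mem⟩

def spinJ {ε : ℝ} (u : SpinField ε) (T : Triangle) : Plane :=
  u ⟨ε • T.j, Set.smul_mem_smul_set T.j_mem⟩

def spinK {ε : ℝ} (u : SpinField ε) (T : Triangle) : Plane :=
  u ⟨ε • T.k, Set.smul_mem_smul_set T.k_mem⟩

/-- The energy `F_ε(u, T) = ε |u(ε i) + u(ε j) + u(ε k)|²`. -/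
def triangleEnergy {ε : ℝ} (u : SpinField ε) (T : Triangle) : ℝ :=
  ε * ‖spinI u T + spinJ u T + spinK u T‖ ^ 2

/-- The energy `F_ε(u, A)`: the sum over all triangles of the lattice `ε ℒ` contained in `A`. -/
def energy {ε : ℝ} (u : SpinField ε) (A : Set Plane) : ℝ≥0∞ :=
  ∑' T : {T : Triangle // T.carrier ε ⊆ A}, ENNReal.ofReal (triangleEnergy u T.1)

/-- The cross product in the plane. -/
def cross (v w : Plane) : ℝ := v 0 * w 1 - v 1 * w 0

/-- The chirality `χ(u, T)` of `u` on a triangle. -/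
def triangleChirality {ε : ℝ} (u : SpinField ε) (T : Triangle) : ℝ :=
  2 / (3 * √3) * (cross (spinI u T) (spinJ u T) + cross (spinJ u T) (spinK u T)
    + cross (spinK u T) (spinI u T))

open Classical in
/-- The chirality `χ(u)`: the function equal to `χ(u, T)` on the interior of each triangle `T`.
The interiors of the triangles are pairwise disjoint, so there is at most one `T` to choose; on
the null set of points in no such interior the value is `0`. -/
def chirality {ε : ℝ} (u : SpinField ε) (x : Plane) : ℝ :=
  if h : ∃ T : Triangle, x ∈ interior (T.carrier ε) then triangleChirality u h.choose else 0

/-- The divergence of a vector field. -/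
def divergence (φ : Plane → Plane) (x : Plane) : ℝ :=
  ∑ m : Fin 2, fderiv ℝ φ x (EuclideanSpace.single m 1) m

/-- `φ ∈ C¹_c(Ω; ℝ²)` with `|φ| ≤ 1`. -/
def IsTestField (Ω : Set Plane) (φ : Plane → Plane) : Prop :=
  ContDiff ℝ 1 φ ∧ HasCompactSupport φ ∧ tsupport φ ⊆ Ω ∧ ∀ x, ‖φ x‖ ≤ 1

/-- The total variation of `f` in `Ω`. -/
def totalVariation (f : Plane → ℝ) (Ω : Set Plane) : ℝ≥0∞ :=
  ⨆ (φ : Plane → Plane) (_ : IsTestField Ω φ),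
    ENNReal.ofReal (∫ x in Ω, f x * divergence φ x)

/-- `f ∈ BV(Ω; {-1, 1})`. -/
def MemBVSign (f : Plane → ℝ) (Ω : Set Plane) : Prop :=
  IntegrableOn f Ω ∧ totalVariation f Ω < ⊤ ∧
    ∀ᵐ x ∂(volume.restrict Ω), f x = -1 ∨ f x = 1

end TriXY

end

/-
The chirality of three unit vectors satisfies `1 - χ² ≤ C |u + v + w|²`, and two triangles with a
common side whose chiralities have opposite signs carry energy bounded from below. Let `σₙ` be
the field equal on each parallelogram of `εₙ ℒ` to the sign of the chirality of its lower
triangle. Then `χ(uₙ) - σₙ` tends to `0` in `L¹`, and moving `σₙ` by `h` costs at most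
`C (|h| + εₙ)` times the energy in `L¹` of any compact subset of `Ω`. Averaging over small `h`
gives strong compactness of `σₙ` up to a uniformly small error. Shifts by exactly one period
bound the difference quotients of `σₙ`, and these bounds pass to the limit in duality with test
functions, so that the limit has finite total variation.
-/

noncomputable section

namespace TriXY

/-! ### Three spins -/

/-- The chirality of three spins. -/
def spinChirality (u v w : Plane) : ℝ :=
  2 / (3 * √3) * (cross u v + cross v w + cross w u)

/-- The sign of a real number with values in `{-1, 1}`; the sign of `0` is `1`. -/
def pmSign (c : ℝ) : ℝ := if 0 ≤ c then 1 else -1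

theorem pmSign_eq_neg_one_or_one (c : ℝ) : pmSign c = -1 ∨ pmSign c = 1 := by
  unfold pmSign
  split_ifs <;> simp

theorem abs_pmSign (c : ℝ) : |pmSign c| = 1 := by
  rcases pmSign_eq_neg_one_or_one c with h | h <;> simp [h]

theorem abs_pmSign_sub_le {c : ℝ} (hc : c ^ 2 ≤ 1) : |pmSign c - c| ≤ 1 - c ^ 2 := by
  obtain ⟨h₁, h₂⟩ := abs_le.mp ((sq_le_one_iff_abs_le_one c).mp hc)
  unfold pmSign
  split_ifs with h
  · rw [abs_of_nonneg (by linarith)]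
    nlinarith
  · rw [abs_of_nonpos (by linarith)]
    nlinarith

theorem cross_sq_add_inner_sq (v w : Plane) :
    cross v w ^ 2 + inner ℝ v w ^ 2 = ‖v‖ ^ 2 * ‖w‖ ^ 2 := by
  simp only [cross, EuclideanSpace.real_norm_sq_eq, PiLp.inner_apply, Fin.sum_univ_two,
    RCLike.inner_apply, conj_trivial]
  ring

theorem abs_cross_le (v w : Plane) : |cross v w| ≤ ‖v‖ * ‖w‖ :=
  abs_le_of_sq_le_sq (by nlinarith [cross_sq_add_inner_sq v w]) (by positivity)

theorem spinChirality_rotate (u v w : Plane) : spinChirality v w u = spinChirality u v w := by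
  unfold spinChirality
  ring

theorem two_div_three_sqrt_three_sq : (2 / (3 * √3)) ^ 2 = 4 / 27 := by
  rw [div_pow, mul_pow, Real.sq_sqrt (by norm_num)]
  norm_num

section UnitSpins

variable {u v w : Plane} (hu : ‖u‖ = 1) (hv : ‖v‖ = 1) (hw : ‖w‖ = 1)
include hu hv hw

-- The area of a triangle with sides `a`, `b`, `c` inscribed in the unit circle is `a * b * c / 4`.
theorem spinChirality_sq :
    spinChirality u v w ^ 2 = ‖u - v‖ ^ 2 * ‖v - w‖ ^ 2 * ‖w - u‖ ^ 2 / 27 := by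
  have gram : ‖u‖ ^ 2 * ‖v‖ ^ 2 * ‖w‖ ^ 2 + 2 * (inner ℝ u v * inner ℝ v w * inner ℝ w u)
      - ‖u‖ ^ 2 * inner ℝ v w ^ 2 - ‖v‖ ^ 2 * inner ℝ w u ^ 2 - ‖w‖ ^ 2 * inner ℝ u v ^ 2 = 0 := by
    simp only [EuclideanSpace.real_norm_sq_eq, PiLp.inner_apply, Fin.sum_univ_two,
      RCLike.inner_apply, conj_trivial]
    ring
  have lagrange := cross_sq_add_inner_sq (v - u) (w - u)
  have h_cross : cross u v + cross v w + cross w u = cross (v - u) (w - u) := by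
    simp only [cross, PiLp.sub_apply]
    ring
  rw [spinChirality, mul_pow, two_div_three_sqrt_three_sq, h_cross]
  simp only [inner_sub_left, inner_sub_right, norm_sub_sq_real, real_inner_self_eq_norm_sq,
    hu, hv, hw, real_inner_comm u w, real_inner_comm u v] at gram lagrange ⊢
  linear_combination 4 / 27 * (lagrange + gram)

theorem sum_norm_sub_sq :
    ‖u - v‖ ^ 2 + ‖v - w‖ ^ 2 + ‖w - u‖ ^ 2 = 9 - ‖u + v + w‖ ^ 2 := by
  simp only [norm_sub_sq_real, norm_add_sq_real, inner_add_left, hu, hv, hw,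
    real_inner_comm u w]
  ring

theorem spinChirality_sq_le_one : spinChirality u v w ^ 2 ≤ 1 := by
  rw [spinChirality_sq hu hv hw]
  have hsum := sum_norm_sub_sq hu hv hw
  have hx := sq_nonneg ‖u - v‖
  have hy := sq_nonneg ‖v - w‖
  have hz := sq_nonneg ‖w - u‖
  generalize ‖u - v‖ ^ 2 = x at *
  generalize ‖v - w‖ ^ 2 = y at *
  generalize ‖w - u‖ ^ 2 = z at *
  -- AM-GM
  have h : (27 : ℝ) * (x * y * z) ≤ (x + y + z) ^ 3 := by
    nlinarith [mul_nonneg hx (sq_nonneg (y - z)), mul_nonneg hy (sq_nonneg (z - x)),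
      mul_nonneg hz (sq_nonneg (x - y)), mul_nonneg hx (sq_nonneg (x - y)),
      mul_nonneg hx (sq_nonneg (x - z)), mul_nonneg hy (sq_nonneg (x - y)),
      mul_nonneg hy (sq_nonneg (y - z)), mul_nonneg hz (sq_nonneg (x - z)),
      mul_nonneg hz (sq_nonneg (y - z))]
  have h9 : (x + y + z) ^ 3 ≤ 9 ^ 3 := by
    gcongr
    linarith [sq_nonneg ‖u + v + w‖]
  linarith

theorem sum_three_sub_norm_sub_sq_sq_le :
    (3 - ‖u - v‖ ^ 2) ^ 2 + (3 - ‖v - w‖ ^ 2) ^ 2 + (3 - ‖w - u‖ ^ 2) ^ 2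
      ≤ 12 * ‖u + v + w‖ ^ 2 := by
  obtain ⟨S, hS⟩ : ∃ S, S = u + v + w := ⟨_, rfl⟩
  have side {a b c : Plane} (ha : ‖a‖ = 1) (hb : ‖b‖ = 1) (hc : ‖c‖ = 1) (h : S = a + b + c) :
      3 - ‖a - b‖ ^ 2 = ‖S‖ ^ 2 - 2 * inner ℝ S c := by
    simp only [h, norm_sub_sq_real, norm_add_sq_real, inner_add_left, real_inner_self_eq_norm_sq,
      ha, hb, hc]
    ring
  have inner_sq {a : Plane} (ha : ‖a‖ = 1) : inner ℝ S a ^ 2 ≤ ‖S‖ ^ 2 := by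
    rw [← sq_abs]
    gcongr
    simpa [ha] using abs_real_inner_le_norm S a
  have hsum : inner ℝ S u + inner ℝ S v + inner ℝ S w = ‖S‖ ^ 2 := by
    rw [← inner_add_right, ← inner_add_right, ← hS, real_inner_self_eq_norm_sq]
  rw [← hS, side hu hv hw hS, side hv hw hu (by rw [hS]; abel), side hw hu hv (by rw [hS]; abel)]
  nlinarith [inner_sq hu, inner_sq hv, inner_sq hw, sq_nonneg (‖S‖ ^ 2)]

theorem one_sub_spinChirality_sq_le : 1 - spinChirality u v w ^ 2 ≤ 2 * ‖u + v + w‖ ^ 2 := by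
  have hsum := sum_norm_sub_sq hu hv hw
  have hdev := sum_three_sub_norm_sub_sq_sq_le hu hv hw
  have side_le {a b : Plane} (ha : ‖a‖ = 1) (hb : ‖b‖ = 1) : |3 - ‖a - b‖ ^ 2| ≤ 3 := by
    have : ‖a - b‖ ≤ 2 := (norm_sub_le a b).trans (by rw [ha, hb]; norm_num)
    rw [abs_le]
    constructor <;> nlinarith [norm_nonneg (a - b)]
  have triple {x y z : ℝ} (hz : |z| ≤ 3) : x * y * z ≤ 3 / 2 * (x ^ 2 + y ^ 2) := by
    have := abs_le.mp hz
    nlinarith [sq_nonneg (x - y), sq_nonneg (x + y)]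
  rw [spinChirality_sq hu hv hw]
  have h₁ := triple (x := 3 - ‖u - v‖ ^ 2) (y := 3 - ‖v - w‖ ^ 2) (side_le hw hu)
  have h₂ := triple (x := 3 - ‖v - w‖ ^ 2) (y := 3 - ‖w - u‖ ^ 2) (side_le hu hv)
  have h₃ := triple (x := 3 - ‖w - u‖ ^ 2) (y := 3 - ‖u - v‖ ^ 2) (side_le hv hw)
  generalize ‖u - v‖ ^ 2 = x at *
  generalize ‖v - w‖ ^ 2 = y at *
  generalize ‖w - u‖ ^ 2 = z at *
  nlinarith [sq_nonneg (x + y + z - 9)]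

theorem abs_spinChirality_le_one : |spinChirality u v w| ≤ 1 :=
  (sq_le_one_iff_abs_le_one _).mp (spinChirality_sq_le_one hu hv hw)

theorem abs_pmSign_spinChirality_sub_le :
    |pmSign (spinChirality u v w) - spinChirality u v w| ≤ 2 * ‖u + v + w‖ ^ 2 :=
  (abs_pmSign_sub_le (spinChirality_sq_le_one hu hv hw)).trans
    (one_sub_spinChirality_sq_le hu hv hw)

end UnitSpins

theorem abs_spinChirality_sub_spinChirality_le {u v w w' : Plane} (hu : ‖u‖ = 1) (hv : ‖v‖ = 1) :
    |spinChirality u v w - spinChirality u v w'| ≤ ‖u + v + w‖ + ‖u + v + w'‖ := by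
  have h_const : 2 / (3 * √3) ≤ 1 / 2 :=
    abs_le_of_sq_le_sq' (by rw [two_div_three_sqrt_three_sq]; norm_num) (by norm_num) |>.2
  have h : spinChirality u v w - spinChirality u v w'
      = 2 / (3 * √3) * cross ((u + v + w) - (u + v + w')) (u - v) := by
    simp only [spinChirality, cross, PiLp.sub_apply, PiLp.add_apply]
    ring
  calc |spinChirality u v w - spinChirality u v w'|
      = 2 / (3 * √3) * |cross ((u + v + w) - (u + v + w')) (u - v)| := by
        rw [h, abs_mul, abs_of_nonneg (by positivity)]
    _ ≤ 1 / 2 * ((‖u + v + w‖ + ‖u + v + w'‖) * (1 + 1)) := by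
        gcongr
        refine (abs_cross_le _ _).trans ?_
        gcongr
        · exact norm_sub_le _ _
        · exact (norm_sub_le u v).trans_eq (by rw [hu, hv])
    _ = ‖u + v + w‖ + ‖u + v + w'‖ := by ring

theorem abs_pmSign_spinChirality_sub_pmSign_le {u v w w' : Plane} (hu : ‖u‖ = 1) (hv : ‖v‖ = 1)
    (hw : ‖w‖ = 1) (hw' : ‖w'‖ = 1) :
    |pmSign (spinChirality u v w) - pmSign (spinChirality u v w')|
      ≤ 5 * (‖u + v + w‖ ^ 2 + ‖u + v + w'‖ ^ 2) := by
  by_cases h_eq : pmSign (spinChirality u v w) = pmSign (spinChirality u v w')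
  · rw [h_eq, sub_self, abs_zero]
    positivity
  have h_two : |pmSign (spinChirality u v w) - pmSign (spinChirality u v w')| = 2 := by
    rcases pmSign_eq_neg_one_or_one (spinChirality u v w) with h | h <;>
      rcases pmSign_eq_neg_one_or_one (spinChirality u v w') with h' | h' <;>
      simp [h, h'] at h_eq ⊢ <;> norm_num
  have h₁ := abs_pmSign_spinChirality_sub_le hu hv hw
  have h₂ := abs_spinChirality_sub_spinChirality_le (w := w) (w' := w') hu hv
  have h₃ := abs_pmSign_spinChirality_sub_le hu hv hw'
  rw [abs_sub_comm] at h₃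
  have h_triangle := (abs_sub_le (pmSign (spinChirality u v w)) (spinChirality u v w)
    (pmSign (spinChirality u v w'))).trans
      (add_le_add_right (abs_sub_le _ (spinChirality u v w') _) _)
  nlinarith [sq_nonneg (‖u + v + w‖ - 1), sq_nonneg (‖u + v + w'‖ - 1)]

/-! ### Lattice triangles -/

theorem linearIndependent_e1_e2 : LinearIndependent ℝ ![e1, e2] := by
  rw [LinearIndependent.pair_iff]
  intro s t h
  have h₀ := congrArg (· 0) h
  have h₁ := congrArg (· 1) h
  simp only [e1, e2, PiLp.add_apply, PiLp.smul_apply, Matrix.cons_val_zero, Matrix.cons_val_one,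
    smul_eq_mul, PiLp.zero_apply] at h₀ h₁
  have ht : t = 0 := by simpa using h₁
  exact ⟨by simpa [ht] using h₀, ht⟩

/-- The basis `ê₁`, `ê₂` of the plane. -/
def latticeBasis : Module.Basis (Fin 2) ℝ Plane :=
  basisOfLinearIndependentOfCardEqFinrank linearIndependent_e1_e2 (by simp)

theorem latticeBasis_zero : latticeBasis 0 = e1 := by simp [latticeBasis]

theorem latticeBasis_one : latticeBasis 1 = e2 := by simp [latticeBasis]

theorem inner_e1_e1 : inner ℝ e1 e1 = (1 : ℝ) := by
  simp only [e1, PiLp.inner_apply, Fin.sum_univ_two, Matrix.cons_val_zero, Matrix.cons_val_one,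
    RCLike.inner_apply, conj_trivial]
  norm_num

theorem inner_e1_e2 : inner ℝ e1 e2 = (1 / 2 : ℝ) := by
  simp [e1, e2, PiLp.inner_apply]

theorem inner_e2_e2 : inner ℝ e2 e2 = (1 : ℝ) := by
  simp only [e2, PiLp.inner_apply, Fin.sum_univ_two, Matrix.cons_val_zero, Matrix.cons_val_one,
    RCLike.inner_apply, conj_trivial]
  linear_combination Real.sq_sqrt (by norm_num : (0 : ℝ) ≤ 3) / 4

theorem norm_latticeBasis (i : Fin 2) : ‖latticeBasis i‖ = 1 := by
  rw [← sq_eq_sq₀ (norm_nonneg _) zero_le_one, ← real_inner_self_eq_norm_sq, one_pow]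
  revert i
  simp [Fin.forall_fin_two, latticeBasis_zero, latticeBasis_one, inner_e1_e1, inner_e2_e2,
    -inner_self_eq_norm_sq_to_K]

theorem norm_smul_latticeBasis (c : ℝ) (i : Fin 2) : ‖c • latticeBasis i‖ = |c| := by
  rw [norm_smul, norm_latticeBasis, mul_one, Real.norm_eq_abs]

theorem norm_le_of_forall_abs_repr_le {x : Plane} {r : ℝ} (h : ∀ i, |latticeBasis.repr x i| ≤ r) :
    ‖x‖ ≤ 2 * r := by
  calc ‖x‖ = ‖∑ i, latticeBasis.repr x i • latticeBasis i‖ := by rw [latticeBasis.sum_repr]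
    _ ≤ ∑ i, ‖latticeBasis.repr x i • latticeBasis i‖ := norm_sum_le _ _
    _ ≤ ∑ _ : Fin 2, r := Finset.sum_le_sum fun i _ => by
        rw [norm_smul_latticeBasis]
        exact h i
    _ = 2 * r := by simp

/-- The point of `ℒ` with integer coordinates `p` with respect to `ê₁`, `ê₂`. -/
def latticePoint (p : Fin 2 → ℤ) : Plane := ∑ i, (p i : ℝ) • latticeBasis i

theorem latticePoint_eq (p : Fin 2 → ℤ) : latticePoint p = (p 0 : ℝ) • e1 + (p 1 : ℝ) • e2 := by
  rw [latticePoint, Fin.sum_univ_two, latticeBasis_zero, latticeBasis_one]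

theorem repr_latticePoint (p : Fin 2 → ℤ) (i : Fin 2) :
    latticeBasis.repr (latticePoint p) i = p i := by
  fin_cases i <;> simp [latticePoint]

theorem latticePoint_injective : Function.Injective latticePoint := fun p q h =>
  funext fun i => by
    have := congrArg (fun x => latticeBasis.repr x i) h
    simpa only [repr_latticePoint, Int.cast_inj] using this

theorem latticePoint_sub (p q : Fin 2 → ℤ) :
    latticePoint (p - q) = latticePoint p - latticePoint q := by
  simp [latticePoint, sub_smul]

theorem latticePoint_single (i : Fin 2) : latticePoint (Pi.single i 1) = latticeBasis i := by
  simp [latticePoint, Pi.single_apply]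

theorem latticePoint_mem_lattice (p : Fin 2 → ℤ) : latticePoint p ∈ lattice :=
  ⟨p 0, p 1, latticePoint_eq p⟩

theorem exists_latticePoint_eq {x : Plane} (hx : x ∈ lattice) : ∃ p, latticePoint p = x := by
  obtain ⟨z₁, z₂, rfl⟩ := hx
  exact ⟨![z₁, z₂], latticePoint_eq _⟩

theorem norm_latticePoint_sq (p : Fin 2 → ℤ) :
    ‖latticePoint p‖ ^ 2 = ((p 0 ^ 2 + p 0 * p 1 + p 1 ^ 2 : ℤ) : ℝ) := by
  rw [← real_inner_self_eq_norm_sq, latticePoint_eq]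
  simp only [inner_add_left, inner_add_right, real_inner_smul_left, real_inner_smul_right,
    inner_e1_e1, inner_e1_e2, inner_e2_e2, real_inner_comm e1 e2]
  push_cast
  ring

theorem norm_latticePoint_eq_one_iff (p : Fin 2 → ℤ) :
    ‖latticePoint p‖ = 1 ↔ p 0 ^ 2 + p 0 * p 1 + p 1 ^ 2 = 1 := by
  rw [← sq_eq_sq₀ (norm_nonneg _) zero_le_one, norm_latticePoint_sq, one_pow]
  norm_cast

theorem latticePoint_mem_sublattice1_iff (p : Fin 2 → ℤ) :
    latticePoint p ∈ sublattice1 ↔ 3 ∣ p 0 - p 1 := by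
  have generators (z₁ z₂ : ℤ) : (z₁ : ℝ) • (e1 + e2) + (z₂ : ℝ) • (e2 + e3)
      = latticePoint ![z₁ - z₂, z₁ + 2 * z₂] := by
    have h_e3 : e3 = e2 - e1 := by
      ext i
      fin_cases i
      · simp [e1, e2, e3]
        norm_num
      · simp [e1, e2, e3]
    rw [latticePoint_eq, h_e3]
    simp only [Matrix.cons_val_zero, Matrix.cons_val_one]
    push_cast
    module
  simp only [sublattice1, Set.mem_ofPred_eq, generators, latticePoint_injective.eq_iff]
  constructor
  · rintro ⟨z₁, z₂, rfl⟩
    exact ⟨-z₂, by simp; ring⟩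
  · rintro ⟨z, hz⟩
    refine ⟨p 0 - z, -z, ?_⟩
    ext i
    fin_cases i <;> simp
    linarith

theorem latticePoint_mem_sublattice2_iff (p : Fin 2 → ℤ) :
    latticePoint p ∈ sublattice2 ↔ 3 ∣ p 0 - p 1 - 1 := by
  have h : latticePoint p ∈ sublattice2 ↔ latticePoint (p - Pi.single 0 1) ∈ sublattice1 := by
    simp [sublattice2, ← sub_eq_iff_eq_add, latticePoint_sub, latticePoint_single,
      latticeBasis_zero]
  rw [h, latticePoint_mem_sublattice1_iff]
  simp [sub_right_comm]

theorem latticePoint_mem_sublattice3_iff (p : Fin 2 → ℤ) :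
    latticePoint p ∈ sublattice3 ↔ 3 ∣ p 0 - p 1 + 1 := by
  have h : latticePoint p ∈ sublattice3 ↔ latticePoint (p - Pi.single 1 1) ∈ sublattice1 := by
    simp [sublattice3, ← sub_eq_iff_eq_add, latticePoint_sub, latticePoint_single, latticeBasis_one]
  rw [h, latticePoint_mem_sublattice1_iff]
  simp [sub_add]

/-- The integer coordinates of the vertices of the two triangles that make up the parallelogram
spanned by `ê₁`, `ê₂` at `p`: the lower one (`h = 0`) has the vertex `p`, the upper one (`h = 1`)
the vertex `p + (1, 1)`, and both have the vertices `p + (1, 0)` and `p + (0, 1)`. The vertices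
are listed so that they lie in `ℒ¹`, `ℒ²`, `ℒ³` up to a cyclic permutation. -/
def faceVertex (h : Fin 2) (p : Fin 2 → ℤ) : Fin 3 → Fin 2 → ℤ :=
  ![fun i => p i + (h : ℕ), p + Pi.single 0 1, p + Pi.single 1 1]

/-- `T` is the lower (`h = 0`) or upper (`h = 1`) triangle of the parallelogram at `p`. -/
def Triangle.IsFace (T : Triangle) (h : Fin 2) (p : Fin 2 → ℤ) : Prop :=
  ∃ r : Fin 3, T.i = latticePoint (faceVertex h p r) ∧ T.j = latticePoint (faceVertex h p (r + 1)) ∧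
    T.k = latticePoint (faceVertex h p (r + 2))

theorem faceVertex_sub_zero_sub_one (h : Fin 2) (p : Fin 2 → ℤ) (r : Fin 3) :
    3 ∣ (faceVertex h p r 0 - faceVertex h p r 1) - (p 0 - p 1 + (r : ℕ)) := by
  fin_cases r <;> simp [faceVertex] <;> omega

theorem norm_latticePoint_faceVertex_sub (h : Fin 2) (p : Fin 2 → ℤ) {r r' : Fin 3} (hr : r ≠ r') :
    ‖latticePoint (faceVertex h p r) - latticePoint (faceVertex h p r')‖ = 1 := by
  rw [← latticePoint_sub, norm_latticePoint_eq_one_iff]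
  fin_cases h <;> fin_cases r <;> fin_cases r' <;> simp [faceVertex] at hr ⊢

theorem exists_isFace (h : Fin 2) (p : Fin 2 → ℤ) : ∃ T : Triangle, T.IsFace h p := by
  obtain ⟨r, hr⟩ : ∃ r : Fin 3, 3 ∣ p 0 - p 1 + (r : ℕ) := by
    have : (p 0 - p 1) % 3 = 0 ∨ (p 0 - p 1) % 3 = 1 ∨ (p 0 - p 1) % 3 = 2 := by omega
    rcases this with h | h | h
    · exact ⟨0, by simp; omega⟩
    · exact ⟨2, by simp; omega⟩
    · exact ⟨1, by simp; omega⟩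
  have h₀ := faceVertex_sub_zero_sub_one h p r
  have h₁ := faceVertex_sub_zero_sub_one h p (r + 1)
  have h₂ := faceVertex_sub_zero_sub_one h p (r + 2)
  refine ⟨⟨latticePoint (faceVertex h p r), latticePoint (faceVertex h p (r + 1)),
    latticePoint (faceVertex h p (r + 2)), latticePoint_mem_lattice _, latticePoint_mem_lattice _,
    latticePoint_mem_lattice _, ?_, ?_, ?_, norm_latticePoint_faceVertex_sub h p ?_,
    norm_latticePoint_faceVertex_sub h p ?_, norm_latticePoint_faceVertex_sub h p ?_⟩,
    r, rfl, rfl, rfl⟩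
  · rw [latticePoint_mem_sublattice1_iff]
    omega
  · rw [latticePoint_mem_sublattice2_iff]
    fin_cases r <;> simp_all <;> omega
  · rw [latticePoint_mem_sublattice3_iff]
    fin_cases r <;> simp_all <;> omega
  all_goals fin_cases r <;> decide

theorem eq_of_norm_latticePoint_sub_eq_one {p q : Fin 2 → ℤ}
    (h_norm : ‖latticePoint p - latticePoint q‖ = 1) (h_dvd : 3 ∣ q 0 - q 1 - (p 0 - p 1) - 1) :
    (q 0 = p 0 + 1 ∧ q 1 = p 1) ∨ (q 0 = p 0 - 1 ∧ q 1 = p 1 + 1) ∨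
      (q 0 = p 0 ∧ q 1 = p 1 - 1) := by
  rw [norm_sub_rev, ← latticePoint_sub, norm_latticePoint_eq_one_iff] at h_norm
  simp only [Pi.sub_apply] at h_norm
  obtain ⟨a, ha⟩ : ∃ a, a = q 0 - p 0 := ⟨_, rfl⟩
  obtain ⟨b, hb⟩ : ∃ b, b = q 1 - p 1 := ⟨_, rfl⟩
  rw [← ha, ← hb] at h_norm
  have : a ≤ 1 := by nlinarith [sq_nonneg (a + 2 * b)]
  have : -1 ≤ a := by nlinarith [sq_nonneg (a + 2 * b)]
  have : b ≤ 1 := by nlinarith [sq_nonneg (b + 2 * a)]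
  have : -1 ≤ b := by nlinarith [sq_nonneg (b + 2 * a)]
  interval_cases a <;> interval_cases b <;> simp_all <;> omega

theorem Triangle.exists_isFace (T : Triangle) : ∃ h p, T.IsFace h p := by
  obtain ⟨p, hp⟩ := exists_latticePoint_eq T.i_mem
  obtain ⟨q, hq⟩ := exists_latticePoint_eq T.j_mem
  obtain ⟨r, hr⟩ := exists_latticePoint_eq T.k_mem
  have hp₁ := (latticePoint_mem_sublattice1_iff p).mp (hp ▸ T.i_mem1)
  have hq₂ := (latticePoint_mem_sublattice2_iff q).mp (hq ▸ T.j_mem2)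
  have hr₃ := (latticePoint_mem_sublattice3_iff r).mp (hr ▸ T.k_mem3)
  have hpq := eq_of_norm_latticePoint_sub_eq_one (hp ▸ hq ▸ T.dist_ij) (by omega)
  have hqr := eq_of_norm_latticePoint_sub_eq_one (hq ▸ hr ▸ T.dist_jk) (by omega)
  have hrp := eq_of_norm_latticePoint_sub_eq_one (hr ▸ hp ▸ T.dist_ki) (by omega)
  have key (h : Fin 2) (s : Fin 2 → ℤ) (t : Fin 3)
      (H : ∀ i, p i = faceVertex h s t i ∧ q i = faceVertex h s (t + 1) i ∧
        r i = faceVertex h s (t + 2) i) : ∃ h p, T.IsFace h p :=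
    ⟨h, s, t, hp ▸ congrArg latticePoint (funext fun i => (H i).1),
      hq ▸ congrArg latticePoint (funext fun i => (H i).2.1),
      hr ▸ congrArg latticePoint (funext fun i => (H i).2.2)⟩
  rcases hpq with ⟨_, _⟩ | ⟨_, _⟩ | ⟨_, _⟩ <;> rcases hqr with ⟨_, _⟩ | ⟨_, _⟩ | ⟨_, _⟩
  · omega
  · exact key 0 p 0 (by intro i; fin_cases i <;> simp [faceVertex] <;> omega)
  · exact key 1 (p - Pi.single 1 1) 2 (by intro i; fin_cases i <;> simp [faceVertex] <;> omega)
  · exact key 1 (p - Pi.single 0 1) 1 (by intro i; fin_cases i <;> simp [faceVertex] <;> omega)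
  · omega
  · exact key 0 (p - Pi.single 0 1) 1 (by intro i; fin_cases i <;> simp [faceVertex] <;> omega)
  · exact key 0 (p - Pi.single 1 1) 2 (by intro i; fin_cases i <;> simp [faceVertex] <;> omega)
  · exact key 1 (p - 1) 0 (by intro i; fin_cases i <;> simp [faceVertex] <;> omega)
  · omega

theorem Triangle.IsFace.eq {T : Triangle} {h h' : Fin 2} {p p' : Fin 2 → ℤ} (hT : T.IsFace h p)
    (hT' : T.IsFace h' p') : h = h' ∧ p = p' := by
  have repr_sum {h p} (hT : T.IsFace h p) (i : Fin 2) :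
      latticeBasis.repr (T.i + T.j + T.k) i = (3 * p i + 1 + (h : ℕ) : ℤ) := by
    obtain ⟨r, hi, hj, hk⟩ := hT
    rw [hi, hj, hk]
    simp only [map_add, Finsupp.add_apply, repr_latticePoint]
    norm_cast
    fin_cases r <;> fin_cases i <;> simp [faceVertex] <;> ring
  have h_eq (i : Fin 2) : 3 * p i + 1 + ((h : ℕ) : ℤ) = 3 * p' i + 1 + ((h' : ℕ) : ℤ) := by
    exact_mod_cast (repr_sum hT i).symm.trans (repr_sum hT' i)
  exact ⟨by have := h_eq 0; omega, by ext i; have := h_eq i; omega⟩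

/-! ### The cells of the lattice -/

theorem mem_convexHull_range_iff {ι E : Type*} [Fintype ι] [AddCommGroup E] [Module ℝ E]
    {v : ι → E} {x : E} :
    x ∈ convexHull ℝ (Set.range v) ↔
      ∃ w : ι → ℝ, (∀ i, 0 ≤ w i) ∧ ∑ i, w i = 1 ∧ ∑ i, w i • v i = x := by
  classical
  have h : Set.range v
      = Fintype.linearCombination ℝ v '' Set.range fun i : ι => (Pi.single i 1 : ι → ℝ) := by
    rw [← Set.range_comp]
    exact congrArg Set.range (funext fun i => by simp)
  rw [h, ← LinearMap.image_convexHull, convexHull_rangle_single_eq_stdSimplex]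
  simp only [Set.mem_image, stdSimplex, Set.mem_ofPred_eq, Fintype.linearCombination_apply,
    and_assoc]

theorem sum_mul_faceVertex {w : Fin 3 → ℝ} (hw : ∑ r, w r = 1) (h : Fin 2) (p : Fin 2 → ℤ)
    (i : Fin 2) : ∑ r, w r * faceVertex h p r i = p i + (h : ℕ) * w 0 + w i.succ := by
  rw [Fin.sum_univ_three] at hw ⊢
  fin_cases i <;> simp [faceVertex]
  · linear_combination (p 0 : ℝ) * hw
  · linear_combination (p 1 : ℝ) * hw

section Cells

variable {ε : ℝ}

/-- The `i`-th coordinate of `x` with respect to `ε ê₁`, `ε ê₂`. -/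
def relCoord (ε : ℝ) (x : Plane) (i : Fin 2) : ℝ := latticeBasis.repr x i / ε

/-- The integer coordinates `p` of the half-open parallelogram of the lattice `ε ℒ` with lowest
vertex `ε p` that contains `x`. -/
def cell (ε : ℝ) (x : Plane) : Fin 2 → ℤ := fun i => ⌊relCoord ε x i⌋

/-- Whether `x` lies in the lower (`0`) or upper (`1`) triangle of its parallelogram. -/
def half (ε : ℝ) (x : Plane) : Fin 2 := if ∑ i, Int.fract (relCoord ε x i) < 1 then 0 else 1

theorem measurable_relCoord (ε : ℝ) (i : Fin 2) : Measurable fun x => relCoord ε x i :=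
  (latticeBasis.coord i).continuous_of_finiteDimensional.measurable.div_const ε

theorem measurable_cell (ε : ℝ) : Measurable (cell ε) :=
  measurable_pi_lambda _ fun i => Int.measurable_floor.comp (measurable_relCoord ε i)

theorem measurable_half (ε : ℝ) : Measurable (half ε) :=
  Measurable.ite (measurableSet_lt
    (Finset.measurable_fun_sum _ fun i _ => measurable_fract.comp (measurable_relCoord ε i))
    measurable_const) measurable_const measurable_const

theorem ae_relCoord_sum_notMem_range_intCast (hε : 0 < ε) {s : Finset (Fin 2)}
    (hs : s.Nonempty) : ∀ᵐ x, ∑ i ∈ s, relCoord ε x i ∉ Set.range ((↑) : ℤ → ℝ) := by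
  obtain ⟨j, hj⟩ := hs
  let L : Plane →ₗ[ℝ] ℝ := ε⁻¹ • ∑ i ∈ s, latticeBasis.coord i
  have hL (x : Plane) : L x = ∑ i ∈ s, relCoord ε x i := by
    simp [L, relCoord, div_eq_inv_mul, Finset.mul_sum]
  have hL_ne : L ≠ 0 := by
    intro h
    have := hL (latticeBasis j)
    simp only [h, LinearMap.zero_apply, relCoord, Module.Basis.repr_self, Finsupp.single_apply,
      ← Finset.sum_div, Finset.sum_ite_eq, if_pos hj] at this
    exact (one_div_pos.mpr hε).ne this
  simp_rw [← hL]
  exact (ae_comp_linearMap_mem_iff L volume volume (LinearMap.surjective hL_ne)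
    (Set.countable_range _).measurableSet.compl).mpr ((Set.countable_range _).ae_notMem volume)

namespace Triangle.IsFace

variable {T : Triangle} {h : Fin 2} {p : Fin 2 → ℤ} {x : Plane}

theorem carrier_eq (hT : T.IsFace h p) (ε : ℝ) :
    T.carrier ε = convexHull ℝ (Set.range fun r => ε • latticePoint (faceVertex h p r)) := by
  obtain ⟨r, hi, hj, hk⟩ := hT
  rw [Triangle.carrier, hi, hj, hk]
  congr 1
  ext x
  simp only [Set.mem_insert_iff, Set.mem_singleton_iff, Set.mem_range, Fin.exists_fin_succ,
    eq_comm (a := x)]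
  fin_cases r <;> simp <;> tauto

theorem mem_carrier_iff_exists (hε : 0 < ε) (hT : T.IsFace h p) :
    x ∈ T.carrier ε ↔ ∃ w : Fin 3 → ℝ, (∀ r, 0 ≤ w r) ∧ ∑ r, w r = 1 ∧
      ∀ i, relCoord ε x i = p i + (h : ℕ) * w 0 + w i.succ := by
  rw [hT.carrier_eq, mem_convexHull_range_iff]
  refine exists_congr fun w => and_congr_right' (and_congr_right fun hw => ?_)
  rw [← latticeBasis.repr.injective.eq_iff, DFunLike.ext_iff]
  refine forall_congr' fun i => ?_
  simp only [map_sum, map_smul, Finsupp.coe_finsetSum, Finset.sum_apply, Finsupp.smul_apply,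
    repr_latticePoint, smul_eq_mul, relCoord, div_eq_iff hε.ne', ← sum_mul_faceVertex hw,
    Finset.sum_mul]
  rw [eq_comm]
  simp only [mul_assoc, mul_comm ε]

theorem mem_carrier_lower_iff (hε : 0 < ε) (hT : T.IsFace 0 p) :
    x ∈ T.carrier ε ↔ (∀ i, p i ≤ relCoord ε x i) ∧ ∑ i, relCoord ε x i ≤ ∑ i, (p i : ℝ) + 1 := by
  simp only [hT.mem_carrier_iff_exists hε, Fin.val_zero, Nat.cast_zero, zero_mul, add_zero,
    Fin.forall_fin_two, Fin.sum_univ_two, Fin.sum_univ_three, Fin.succ_zero_eq_one,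
    Fin.succ_one_eq_two]
  constructor
  · rintro ⟨w, hw, h_sum, h₀, h₁⟩
    refine ⟨⟨?_, ?_⟩, ?_⟩ <;> linarith [hw 0, hw 1, hw 2]
  · rintro ⟨⟨h₀, h₁⟩, h_sum⟩
    refine ⟨![1 - (relCoord ε x 0 - p 0) - (relCoord ε x 1 - p 1), relCoord ε x 0 - p 0,
      relCoord ε x 1 - p 1], ?_, ?_, ?_, ?_⟩
    · intro r
      fin_cases r <;> simp <;> linarith
    · simp
      ring
    all_goals simp

theorem mem_carrier_upper_iff (hε : 0 < ε) (hT : T.IsFace 1 p) :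
    x ∈ T.carrier ε ↔
      (∀ i, relCoord ε x i ≤ p i + 1) ∧ ∑ i, (p i : ℝ) + 1 ≤ ∑ i, relCoord ε x i := by
  simp only [hT.mem_carrier_iff_exists hε, Fin.val_one, Nat.cast_one, one_mul,
    Fin.forall_fin_two, Fin.sum_univ_two, Fin.sum_univ_three, Fin.succ_zero_eq_one,
    Fin.succ_one_eq_two]
  constructor
  · rintro ⟨w, hw, h_sum, h₀, h₁⟩
    refine ⟨⟨?_, ?_⟩, ?_⟩ <;> linarith [hw 0, hw 1, hw 2]
  · rintro ⟨⟨h₀, h₁⟩, h_sum⟩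
    refine ⟨![relCoord ε x 0 - p 0 + (relCoord ε x 1 - p 1) - 1, p 1 + 1 - relCoord ε x 1,
      p 0 + 1 - relCoord ε x 0], ?_, ?_, ?_, ?_⟩
    · intro r
      fin_cases r <;> simp <;> linarith
    all_goals
      simp
      ring

theorem mem_carrier (hε : 0 < ε) (hT : T.IsFace (half ε x) (cell ε x)) : x ∈ T.carrier ε := by
  have h_le (i : Fin 2) : (cell ε x i : ℝ) ≤ relCoord ε x i := Int.floor_le _
  have h_ge (i : Fin 2) : relCoord ε x i ≤ cell ε x i + 1 := (Int.lt_floor_add_one _).le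
  have h_fract : ∑ i, Int.fract (relCoord ε x i) = ∑ i, relCoord ε x i - ∑ i, (cell ε x i : ℝ) := by
    simp only [Int.fract, cell, Finset.sum_sub_distrib]
  by_cases h : ∑ i, Int.fract (relCoord ε x i) < 1
  · rw [half, if_pos h] at hT
    exact (hT.mem_carrier_lower_iff hε).mpr ⟨h_le, by linarith⟩
  · rw [half, if_neg h] at hT
    exact (hT.mem_carrier_upper_iff hε).mpr ⟨h_ge, by linarith⟩

theorem half_eq_and_cell_eq (hε : 0 < ε)
    (hx : ∀ i, relCoord ε x i ∉ Set.range ((↑) : ℤ → ℝ))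
    (hx_sum : ∑ i, relCoord ε x i ∉ Set.range ((↑) : ℤ → ℝ))
    (hT : T.IsFace h p) (hxT : x ∈ T.carrier ε) : half ε x = h ∧ cell ε x = p := by
  have hx_sum' : ∑ i, relCoord ε x i ≠ ∑ i, (p i : ℝ) + 1 := fun h => hx_sum ⟨∑ i, p i + 1, by
    rw [h]; push_cast; rfl⟩
  have cell_eq (h_ge : ∀ i, p i ≤ relCoord ε x i) (h_le : ∀ i, relCoord ε x i ≤ p i + 1) :
      cell ε x = p := funext fun i => Int.floor_eq_iff.mpr
    ⟨h_ge i, (h_le i).lt_of_ne fun h => hx i ⟨p i + 1, by rw [h]; push_cast; rfl⟩⟩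
  have half_eq (h_cell : cell ε x = p) : half ε x
      = if ∑ i, relCoord ε x i < ∑ i, (p i : ℝ) + 1 then 0 else 1 := by
    simp only [half, Int.fract, Finset.sum_sub_distrib, sub_lt_iff_lt_add', ← h_cell, cell]
  simp only [Fin.sum_univ_two] at hx_sum' half_eq
  fin_cases h
  · obtain ⟨h_ge, h_sum⟩ := (hT.mem_carrier_lower_iff hε).mp hxT
    simp only [Fin.sum_univ_two, Fin.forall_fin_two] at h_sum h_ge
    have h_cell := cell_eq (Fin.forall_fin_two.mpr h_ge)
      (Fin.forall_fin_two.mpr ⟨by linarith, by linarith⟩)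
    exact ⟨(half_eq h_cell).trans (if_pos (h_sum.lt_of_ne hx_sum')), h_cell⟩
  · obtain ⟨h_le, h_sum⟩ := (hT.mem_carrier_upper_iff hε).mp hxT
    simp only [Fin.sum_univ_two, Fin.forall_fin_two] at h_sum h_le
    have h_cell := cell_eq (Fin.forall_fin_two.mpr ⟨by linarith, by linarith⟩)
      (Fin.forall_fin_two.mpr h_le)
    exact ⟨(half_eq h_cell).trans (if_neg h_sum.not_gt), h_cell⟩

end Triangle.IsFace

theorem ae_mem_interior_carrier (hε : 0 < ε) :
    ∀ᵐ x, ∃ T : Triangle, x ∈ interior (T.carrier ε) := by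
  choose T hT using exists_isFace
  have h_frontier : ∀ᵐ x, ∀ h p, x ∉ frontier ((T h p).carrier ε) := by
    simp only [ae_all_iff]
    exact fun h p => measure_eq_zero_iff_ae_notMem.mp ((convex_convexHull ℝ _).addHaar_frontier _)
  filter_upwards [h_frontier] with x hx
  exact ⟨T (half ε x) (cell ε x), of_not_not fun h => hx _ _
    ⟨subset_closure ((hT _ _).mem_carrier hε), h⟩⟩

theorem ae_isFace_of_mem_interior (hε : 0 < ε) :
    ∀ᵐ x, ∀ T : Triangle, x ∈ interior (T.carrier ε) → T.IsFace (half ε x) (cell ε x) := by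
  have h_single := ae_all_iff.mpr fun i =>
    ae_relCoord_sum_notMem_range_intCast hε (Finset.singleton_nonempty i)
  filter_upwards [h_single, ae_relCoord_sum_notMem_range_intCast hε Finset.univ_nonempty]
    with x hx hx_sum T hxT
  obtain ⟨h, p, hT⟩ := T.exists_isFace
  simp only [Finset.sum_singleton] at hx
  obtain ⟨rfl, rfl⟩ := hT.half_eq_and_cell_eq hε hx hx_sum (interior_subset hxT)
  exact hT

theorem norm_sub_le_of_relCoord {x y : Plane} (hε : 0 < ε)
    (h : ∀ i, |relCoord ε x i - relCoord ε y i| ≤ 1) : ‖x - y‖ ≤ 2 * ε := by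
  refine norm_le_of_forall_abs_repr_le fun i => ?_
  have := h i
  rwa [relCoord, relCoord, ← sub_div, abs_div, abs_of_pos hε, div_le_one hε,
    ← Finsupp.sub_apply, ← map_sub] at this

theorem Triangle.IsFace.carrier_subset_closedBall {T : Triangle} {h : Fin 2} {x : Plane}
    (hε : 0 < ε) (hT : T.IsFace h (cell ε x)) :
    T.carrier ε ⊆ Metric.closedBall x (2 * ε) := by
  have h_le (i : Fin 2) : (cell ε x i : ℝ) ≤ relCoord ε x i := Int.floor_le _
  have h_lt (i : Fin 2) : relCoord ε x i < cell ε x i + 1 := Int.lt_floor_add_one _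
  intro y hy
  rw [mem_closedBall_iff_norm]
  refine norm_sub_le_of_relCoord hε ?_
  simp only [Fin.forall_fin_two, abs_le] at h_le h_lt ⊢
  fin_cases h
  · obtain ⟨h_ge, h_sum⟩ := (hT.mem_carrier_lower_iff hε).mp hy
    simp only [Fin.forall_fin_two, Fin.sum_univ_two] at h_ge h_sum
    refine ⟨⟨?_, ?_⟩, ?_, ?_⟩ <;> linarith
  · obtain ⟨h_le, h_sum⟩ := (hT.mem_carrier_upper_iff hε).mp hy
    simp only [Fin.forall_fin_two, Fin.sum_univ_two] at h_le h_sum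
    refine ⟨⟨?_, ?_⟩, ?_, ?_⟩ <;> linarith

theorem volume_cell_preimage_singleton_le (hε : 0 < ε) (p : Fin 2 → ℤ) :
    volume (cell ε ⁻¹' {p}) ≤ 16 * ENNReal.ofReal ε ^ 2 := by
  have h_sub : cell ε ⁻¹' {p} ⊆ Metric.closedBall (ε • latticePoint p) (2 * ε) := by
    rintro x rfl
    rw [mem_closedBall_iff_norm]
    refine norm_sub_le_of_relCoord hε fun i => ?_
    have h_pt : relCoord ε (ε • latticePoint (cell ε x)) i = ⌊relCoord ε x i⌋ := by
      simp [relCoord, repr_latticePoint, hε.ne', cell]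
    rw [h_pt, Int.self_sub_floor, Int.abs_fract]
    exact (Int.fract_lt_one _).le
  refine (measure_mono h_sub).trans ?_
  rw [EuclideanSpace.volume_closedBall_fin_two, ← ENNReal.ofReal_pow (by positivity),
    ← ENNReal.ofReal_pow (by positivity), ← ENNReal.ofReal_mul (by positivity),
    ← ENNReal.ofReal_ofNat 16, ← ENNReal.ofReal_mul (by positivity)]
  refine ENNReal.ofReal_le_ofReal ?_
  nlinarith [Real.pi_le_four, sq_nonneg ε]

end Cells

/-! ### Spin fields on the cells -/

section SpinFields

variable {ε : ℝ} (u : SpinField ε)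

/-- The spin of `u` at the lattice point `ε p`. -/
def spinAt (p : Fin 2 → ℤ) : Plane :=
  u ⟨ε • latticePoint p, Set.smul_mem_smul_set (latticePoint_mem_lattice p)⟩

/-- The sum of the three spins on a triangle of the parallelogram at `p`. -/
def faceSum (h : Fin 2) (p : Fin 2 → ℤ) : Plane := ∑ r, spinAt u (faceVertex h p r)

/-- The chirality on a triangle of the parallelogram at `p`. -/
def faceChirality (h : Fin 2) (p : Fin 2 → ℤ) : ℝ :=
  spinChirality (spinAt u (faceVertex h p 0)) (spinAt u (faceVertex h p 1))
    (spinAt u (faceVertex h p 2))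

/-- The sign attached to the parallelogram at `p`, read off its lower triangle. -/
def cellSign (p : Fin 2 → ℤ) : ℝ := pmSign (faceChirality u 0 p)

/-- The energy of the two triangles of the parallelogram at `p`, divided by `ε`. -/
def cellExcess (p : Fin 2 → ℤ) : ℝ≥0∞ := ∑ h, ‖faceSum u h p‖ₑ ^ 2

theorem norm_spinAt (p : Fin 2 → ℤ) : ‖spinAt u p‖ = 1 := norm_eq_of_mem_sphere _

theorem faceSum_eq (h : Fin 2) (p : Fin 2 → ℤ) (r : Fin 3) :
    faceSum u h p = spinAt u (faceVertex h p r) + spinAt u (faceVertex h p (r + 1))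
      + spinAt u (faceVertex h p (r + 2)) := by
  rw [faceSum, Fin.sum_univ_three]
  fin_cases r <;> simp <;> abel

theorem faceChirality_eq (h : Fin 2) (p : Fin 2 → ℤ) (r : Fin 3) :
    faceChirality u h p = spinChirality (spinAt u (faceVertex h p r))
      (spinAt u (faceVertex h p (r + 1))) (spinAt u (faceVertex h p (r + 2))) := by
  fin_cases r
  · rfl
  · exact (spinChirality_rotate _ _ _).symm
  · exact spinChirality_rotate _ _ _

namespace Triangle.IsFace

variable {u} {T : Triangle} {h : Fin 2} {p : Fin 2 → ℤ}

theorem spin_sum_eq (hT : T.IsFace h p) : spinI u T + spinJ u T + spinK u T = faceSum u h p := by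
  obtain ⟨r, hi, hj, hk⟩ := hT
  simp only [faceSum_eq u h p r, spinI, spinJ, spinK, hi, hj, hk, spinAt]

theorem triangleChirality_eq (hT : T.IsFace h p) : triangleChirality u T = faceChirality u h p := by
  obtain ⟨r, hi, hj, hk⟩ := hT
  simp only [faceChirality_eq u h p r, triangleChirality, spinChirality, spinI, spinJ, spinK, hi,
    hj, hk, spinAt]

end Triangle.IsFace

theorem ae_chirality_eq (hε : 0 < ε) :
    ∀ᵐ x, chirality u x = faceChirality u (half ε x) (cell ε x) := by
  filter_upwards [ae_mem_interior_carrier hε, ae_isFace_of_mem_interior hε] with x hx h_face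
  rw [chirality, dif_pos hx, (h_face _ hx.choose_spec).triangleChirality_eq]

theorem ofReal_mul_tsum_cellExcess_le_energy {S : Set (Fin 2 → ℤ)} {Ω : Set Plane}
    (hS : ∀ T h, ∀ p ∈ S, Triangle.IsFace T h p → T.carrier ε ⊆ Ω) :
    ENNReal.ofReal ε * ∑' p : S, cellExcess u p ≤ energy u Ω := by
  choose T hT using exists_isFace
  let f (q : S × Fin 2) : {T : Triangle // T.carrier ε ⊆ Ω} :=
    ⟨T q.2 q.1, hS _ _ _ q.1.2 (hT _ _)⟩
  have hf : Function.Injective f := fun q q' h => by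
    have h_eq : T q.2 q.1 = T q'.2 q'.1 := congrArg Subtype.val h
    obtain ⟨h_half, h_cell⟩ := (hT q.2 q.1).eq (h_eq ▸ hT q'.2 q'.1)
    exact Prod.ext (Subtype.ext h_cell) h_half
  calc ENNReal.ofReal ε * ∑' p : S, cellExcess u p
      = ∑' q : S × Fin 2, ENNReal.ofReal (triangleEnergy u (f q).1) := by
        rw [ENNReal.tsum_prod (f := fun (p : S) h => ENNReal.ofReal (triangleEnergy u (T h p))),
          ← ENNReal.tsum_mul_left]
        refine tsum_congr fun p => ?_
        rw [tsum_fintype, cellExcess, Finset.mul_sum]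
        refine Finset.sum_congr rfl fun h _ => ?_
        rw [triangleEnergy, (hT h p).spin_sum_eq, ENNReal.ofReal_mul' (by positivity),
          ENNReal.ofReal_pow (norm_nonneg _), ofReal_norm]
    _ ≤ energy u Ω := ENNReal.tsum_comp_le_tsum_of_injective hf _

theorem lintegral_cellExcess_le (hε : 0 < ε) {A Ω : Set Plane}
    (hA : ∀ x ∈ A, Metric.closedBall x (2 * ε) ⊆ Ω) :
    ∫⁻ x in A, cellExcess u (cell ε x) ≤ 16 * ENNReal.ofReal ε * energy u Ω := by
  have h_energy := ofReal_mul_tsum_cellExcess_le_energy u (S := cell ε '' A) (Ω := Ω) <| by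
    rintro T h _ ⟨x, hx, rfl⟩ hT
    exact (hT.carrier_subset_closedBall hε).trans (hA x hx)
  rw [tsum_subtype (cell ε '' A)] at h_energy
  set F : (Fin 2 → ℤ) → ℝ≥0∞ := (cell ε '' A).indicator (cellExcess u) with hF
  calc ∫⁻ x in A, cellExcess u (cell ε x)
      ≤ ∫⁻ x in A, F (cell ε x) := setLIntegral_mono
        ((measurable_of_countable F).comp (measurable_cell ε)) fun x hx => by
          rw [hF, Set.indicator_of_mem (Set.mem_image_of_mem _ hx)]
    _ ≤ ∫⁻ x, F (cell ε x) := setLIntegral_le_lintegral _ _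
    _ = ∑' p, F p * volume (cell ε ⁻¹' {p}) := by
        rw [← lintegral_map (measurable_of_countable F) (measurable_cell ε), lintegral_countable']
        simp only [Measure.map_apply (measurable_cell ε) (measurableSet_singleton _)]
    _ ≤ ∑' p, F p * (16 * ENNReal.ofReal ε ^ 2) := by
        gcongr with p
        exact volume_cell_preimage_singleton_le hε p
    _ = 16 * ENNReal.ofReal ε * (ENNReal.ofReal ε * ∑' p, F p) := by
        rw [ENNReal.tsum_mul_right]
        ring
    _ ≤ 16 * ENNReal.ofReal ε * energy u Ω := by gcongr

theorem enorm_pmSign_faceChirality_sub_le {h h' : Fin 2} {p p' : Fin 2 → ℤ} {r r' : Fin 3}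
    (h_eq : faceVertex h p r = faceVertex h' p' r')
    (h_eq' : faceVertex h p (r + 1) = faceVertex h' p' (r' + 1)) :
    ‖pmSign (faceChirality u h p) - pmSign (faceChirality u h' p')‖ₑ
      ≤ 5 * (‖faceSum u h p‖ₑ ^ 2 + ‖faceSum u h' p'‖ₑ ^ 2) := by
  rw [faceChirality_eq u h p r, faceChirality_eq u h' p' r', faceSum_eq u h p r,
    faceSum_eq u h' p' r', ← h_eq, ← h_eq']
  rw [Real.enorm_eq_ofReal_abs]
  refine (ENNReal.ofReal_le_ofReal (abs_pmSign_spinChirality_sub_pmSign_le (norm_spinAt u _)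
    (norm_spinAt u _) (norm_spinAt u _) (norm_spinAt u _))).trans_eq ?_
  rw [ENNReal.ofReal_mul (by norm_num), ENNReal.ofReal_add (by positivity) (by positivity),
    ENNReal.ofReal_pow (norm_nonneg _), ENNReal.ofReal_pow (norm_nonneg _), ofReal_norm,
    ofReal_norm, ENNReal.ofReal_ofNat]

theorem enorm_faceSum_sq_le_cellExcess (h : Fin 2) (p : Fin 2 → ℤ) :
    ‖faceSum u h p‖ₑ ^ 2 ≤ cellExcess u p :=
  Finset.single_le_sum (f := fun h => ‖faceSum u h p‖ₑ ^ 2) (fun _ _ => zero_le)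
    (Finset.mem_univ h)

theorem enorm_pmSign_faceChirality_sub_cellSign_le (h : Fin 2) (p : Fin 2 → ℤ) :
    ‖pmSign (faceChirality u h p) - cellSign u p‖ₑ ≤ 5 * cellExcess u p := by
  revert h
  refine Fin.forall_fin_two.mpr ⟨?_, ?_⟩
  · simp [cellSign]
  · rw [cellExcess, Fin.sum_univ_two, add_comm]
    exact enorm_pmSign_faceChirality_sub_le u (r := 1) (r' := 1) rfl rfl

theorem enorm_faceChirality_sub_cellSign_le (h : Fin 2) (p : Fin 2 → ℤ) :
    ‖faceChirality u h p - cellSign u p‖ₑ ≤ 7 * cellExcess u p := by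
  have h_sign : ‖faceChirality u h p - pmSign (faceChirality u h p)‖ₑ ≤ 2 * cellExcess u p := by
    refine le_trans ?_ (mul_le_mul_right (enorm_faceSum_sq_le_cellExcess u h p) 2)
    rw [enorm_sub_rev, faceSum_eq u h p 0, Real.enorm_eq_ofReal_abs]
    refine (ENNReal.ofReal_le_ofReal (abs_pmSign_spinChirality_sub_le (norm_spinAt u _)
      (norm_spinAt u _) (norm_spinAt u _))).trans_eq ?_
    rw [ENNReal.ofReal_mul (by norm_num), ENNReal.ofReal_pow (norm_nonneg _), ofReal_norm,
      ENNReal.ofReal_ofNat]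
    rfl
  calc ‖faceChirality u h p - cellSign u p‖ₑ
      ≤ ‖faceChirality u h p - pmSign (faceChirality u h p)‖ₑ
        + ‖pmSign (faceChirality u h p) - cellSign u p‖ₑ := by
        rw [← sub_add_sub_cancel]
        exact enorm_add_le _ _
    _ ≤ 2 * cellExcess u p + 5 * cellExcess u p :=
        add_le_add h_sign (enorm_pmSign_faceChirality_sub_cellSign_le u h p)
    _ = 7 * cellExcess u p := by ring

theorem enorm_cellSign_add_single_sub_le (i : Fin 2) (p : Fin 2 → ℤ) :
    ‖cellSign u (p + Pi.single i 1) - cellSign u p‖ₑ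
      ≤ 10 * (cellExcess u p + cellExcess u (p + Pi.single i 1)) := by
  have h_upper : ‖pmSign (faceChirality u 1 p) - cellSign u (p + Pi.single i 1)‖ₑ
      ≤ 5 * (‖faceSum u 1 p‖ₑ ^ 2 + ‖faceSum u 0 (p + Pi.single i 1)‖ₑ ^ 2) := by
    fin_cases i
    · refine enorm_pmSign_faceChirality_sub_le u (r := 0) (r' := 2) ?_ ?_ <;>
      · ext j
        fin_cases j <;> simp [faceVertex]
    · refine enorm_pmSign_faceChirality_sub_le u (r := 2) (r' := 0) ?_ ?_ <;>
      · ext j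
        fin_cases j <;> simp [faceVertex]
  rw [enorm_sub_rev] at h_upper
  calc ‖cellSign u (p + Pi.single i 1) - cellSign u p‖ₑ
      ≤ ‖cellSign u (p + Pi.single i 1) - pmSign (faceChirality u 1 p)‖ₑ
        + ‖pmSign (faceChirality u 1 p) - cellSign u p‖ₑ := by
        rw [← sub_add_sub_cancel]
        exact enorm_add_le _ _
    _ ≤ 5 * (cellExcess u p + cellExcess u (p + Pi.single i 1)) + 5 * cellExcess u p := by
        refine add_le_add (h_upper.trans ?_) (enorm_pmSign_faceChirality_sub_cellSign_le u 1 p)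
        gcongr <;> exact enorm_faceSum_sq_le_cellExcess u _ _
    _ ≤ 5 * (cellExcess u p + cellExcess u (p + Pi.single i 1))
        + 5 * (cellExcess u p + cellExcess u (p + Pi.single i 1)) := by
        gcongr
        exact le_self_add
    _ = 10 * (cellExcess u p + cellExcess u (p + Pi.single i 1)) := by ring

end SpinFields
/-! ### Compactness from translation estimates -/

theorem exists_subseq_tendsto_setIntegral {α : Type*} [MeasurableSpace α]
    [MeasurableSpace.CountablyGenerated α] (μ : Measure α) [IsFiniteMeasure μ] {f : ℕ → α → ℝ}
    {C : ℝ} (hf : ∀ n, AEStronglyMeasurable (f n) μ) (hfC : ∀ n, ∀ᵐ x ∂μ, ‖f n x‖ ≤ C) :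
    ∃ s : ℕ → ℕ, StrictMono s ∧ ∀ A, MeasurableSet A →
      ∃ l : ℝ, Tendsto (fun n => ∫ x in A, f (s n) x ∂μ) atTop (𝓝 l) := by
  have : Fact ((2 : ℝ≥0∞) ≠ ⊤) := ⟨ENNReal.ofNat_ne_top⟩
  have hmem (n : ℕ) : MemLp (f n) 2 μ := MemLp.of_bound (hf n) C (hfC n)
  have hnorm (n : ℕ) :
      ‖(hmem n).toLp (f n)‖ ≤ (measureUnivNNReal μ : ℝ) ^ (2 : ℝ≥0∞).toReal⁻¹ * |C| := by
    refine Lp.norm_le_of_ae_bound (abs_nonneg C) ?_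
    filter_upwards [(hmem n).coeFn_toLp, hfC n] with x hx hxC
    exact hx ▸ hxC.trans (le_abs_self C)
  obtain ⟨l, -, s, hs, hl⟩ := WeakDual.isSeqCompact_closedBall ℝ (Lp ℝ 2 μ) 0 _
    (x := fun n => StrongDual.toWeakDual (innerSL ℝ ((hmem n).toLp (f n)))) fun n => by
      simpa using hnorm n
  refine ⟨s, hs, fun A hA => ⟨l (indicatorConstLp 2 hA (measure_ne_top μ A) 1), ?_⟩⟩
  refine (((WeakDual.eval_continuous
    (indicatorConstLp 2 hA (measure_ne_top μ A) (1 : ℝ))).tendsto l).comp hl).congr fun n => ?_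
  calc inner ℝ ((hmem (s n)).toLp (f (s n))) (indicatorConstLp 2 hA (measure_ne_top μ A) (1 : ℝ))
      = ∫ x in A, (hmem (s n)).toLp (f (s n)) x ∂μ := by
        rw [real_inner_comm, L2.inner_indicatorConstLp_one]
    _ = ∫ x in A, f (s n) x ∂μ :=
        setIntegral_congr_ae hA ((hmem (s n)).coeFn_toLp.mono fun x hx _ => hx)

theorem exists_tendsto_eLpNorm_of_forall_exists_approx {α F : Type*} [MeasurableSpace α]
    {μ : Measure α} [NormedAddCommGroup F] [CompleteSpace F] {p : ℝ≥0∞} [hp : Fact (1 ≤ p)]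
    {f : ℕ → α → F} (hf : ∀ n, MemLp (f n) p μ)
    (H : ∀ η : ℝ≥0∞, η ≠ 0 → ∃ g, AEStronglyMeasurable g μ ∧
      ∀ᶠ n in atTop, eLpNorm (f n - g) p μ ≤ η) :
    ∃ g, MemLp g p μ ∧ Tendsto (fun n => eLpNorm (f n - g) p μ) atTop (𝓝 0) := by
  have hcauchy : CauchySeq fun n => (hf n).toLp (f n) := by
    rw [EMetric.cauchySeq_iff]
    intro r hr
    obtain ⟨η, hη0, hη⟩ := ENNReal.exists_nnreal_pos_mul_lt (a := 2) (by simp) hr.ne'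
    obtain ⟨g, hg, hfg⟩ := H η (by exact_mod_cast hη0.ne')
    obtain ⟨N, hN⟩ := hfg.exists_forall_of_atTop
    refine ⟨N, fun i hi j hj => ?_⟩
    calc edist ((hf i).toLp (f i)) ((hf j).toLp (f j))
        = eLpNorm ((f i - g) - (f j - g)) p μ := by
          rw [Lp.edist_toLp_toLp, sub_sub_sub_cancel_right]
      _ ≤ eLpNorm (f i - g) p μ + eLpNorm (f j - g) p μ :=
          eLpNorm_sub_le ((hf i).1.sub hg) ((hf j).1.sub hg) hp.out
      _ ≤ η + η := add_le_add (hN i hi) (hN j hj)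
      _ = η * 2 := (mul_two _).symm
      _ < r := hη
  obtain ⟨g, hg⟩ := cauchySeq_tendsto_of_complete hcauchy
  rw [Lp.tendsto_Lp_iff_tendsto_eLpNorm'] at hg
  exact ⟨g, Lp.memLp g, hg.congr fun n => eLpNorm_congr_ae
    ((hf n).coeFn_toLp.sub (EventuallyEq.refl _ _))⟩

section Translation

variable {G : Type*} [AddCommGroup G] [MeasurableSpace G] [MeasurableAdd₂ G] {μ : Measure G}

theorem lintegral_integral_add_sub_le [SFinite μ] {F : Type*} [NormedAddCommGroup F]
    [NormedSpace ℝ F] [CompleteSpace F] {ν : Measure G} [IsProbabilityMeasure ν] {g : G → F} {C : ℝ}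
    (hg : StronglyMeasurable g) (hgC : ∀ x, ‖g x‖ ≤ C) {K : Set G} {η : ℝ≥0∞}
    (H : ∀ᵐ h ∂ν, ∫⁻ x in K, ‖g (x + h) - g x‖ₑ ∂μ ≤ η) :
    ∫⁻ x in K, ‖(∫ h, g (x + h) ∂ν) - g x‖ₑ ∂μ ≤ η :=
  have hint (x : G) : Integrable (fun h => g (x + h)) ν :=
    .of_bound (hg.comp_measurable (measurable_const_add x)).aestronglyMeasurable C
      (ae_of_all _ fun h => hgC _)
  calc ∫⁻ x in K, ‖(∫ h, g (x + h) ∂ν) - g x‖ₑ ∂μ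
      = ∫⁻ x in K, ‖∫ h, (g (x + h) - g x) ∂ν‖ₑ ∂μ := by
        simp only [integral_sub (hint _) (integrable_const _), integral_const, probReal_univ,
          one_smul]
    _ ≤ ∫⁻ x in K, ∫⁻ h, ‖g (x + h) - g x‖ₑ ∂ν ∂μ :=
        lintegral_mono fun x => enorm_integral_le_lintegral_enorm _
    _ = ∫⁻ h, ∫⁻ x in K, ‖g (x + h) - g x‖ₑ ∂μ ∂ν :=
        lintegral_lintegral_swap ((hg.comp_measurable measurable_add).sub
          (hg.comp_measurable measurable_fst)).enorm.aemeasurable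
    _ ≤ ∫⁻ _, η ∂ν := lintegral_mono_ae H
    _ = η := by simp

theorem integral_add_cond_eq [μ.IsAddLeftInvariant] {F : Type*} [NormedAddCommGroup F]
    [NormedSpace ℝ F] {B Ω : Set G}
    (hB : MeasurableSet B) {x : G} (hx : ∀ h ∈ B, x + h ∈ Ω) (g : G → F) :
    ∫ h, g (x + h) ∂(ProbabilityTheory.cond μ B) =
      (μ B)⁻¹.toReal • ∫ y in (-x + ·) ⁻¹' B, g y ∂(μ.restrict Ω) := by
  have hBx : MeasurableSet ((-x + ·) ⁻¹' B) := measurable_const_add _ hB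
  have hsub : (-x + ·) ⁻¹' B ⊆ Ω := fun y hy => by simpa using hx _ hy
  have hshift : ∫ h in B, g (x + h) ∂μ = ∫ y in (-x + ·) ⁻¹' B, g y ∂μ := by
    simpa [Set.preimage_preimage] using (measurePreserving_add_left μ x).setIntegral_preimage_emb
      (measurableEmbedding_addLeft x) g ((-x + ·) ⁻¹' B)
  rw [ProbabilityTheory.cond, integral_smul_measure, Measure.restrict_restrict hBx,
    Set.inter_eq_left.mpr hsub, hshift]

theorem exists_tendsto_integral_add_cond [μ.IsAddLeftInvariant] {f : ℕ → G → ℝ} {C : ℝ}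
    (hf : ∀ n, Measurable (f n)) (hfC : ∀ n x, ‖f n x‖ ≤ C) {B K Ω : Set G}
    (hweak : ∀ A, MeasurableSet A →
      ∃ l : ℝ, Tendsto (fun n => ∫ x in A, f n x ∂(μ.restrict Ω)) atTop (𝓝 l))
    (hK : MeasurableSet K) (hK_fin : μ K ≠ ⊤) (hB : MeasurableSet B)
    (hBΩ : ∀ x ∈ K, ∀ h ∈ B, x + h ∈ Ω) :
    ∃ g, AEStronglyMeasurable g (μ.restrict K) ∧
      Tendsto (fun n => ∫⁻ x in K, ‖(∫ h, f n (x + h) ∂(ProbabilityTheory.cond μ B)) - g x‖ₑ ∂μ)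
        atTop (𝓝 0) := by
  set ν := ProbabilityTheory.cond μ B
  have : IsFiniteMeasure (μ.restrict K) := ⟨by simpa using hK_fin.lt_top⟩
  set a : ℕ → G → ℝ := fun n x => ∫ h, f n (x + h) ∂ν
  have ha (n : ℕ) : AEStronglyMeasurable (a n) (μ.restrict K) :=
    (StronglyMeasurable.integral_prod_right (f := fun x h => f n (x + h))
      ((hf n).comp measurable_add).stronglyMeasurable).aestronglyMeasurable
  have haC (n : ℕ) (x : G) : ‖a n x‖ ≤ C * ν.real Set.univ :=
    norm_integral_le_of_norm_le_const (ae_of_all ν fun h => hfC n (x + h))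
  have hlim : ∀ x ∈ K, ∃ l, Tendsto (a · x) atTop (𝓝 l) := fun x hx => by
    obtain ⟨l, hl⟩ := hweak ((-x + ·) ⁻¹' B) (measurable_const_add _ hB)
    exact ⟨_, by simpa only [a, ν, integral_add_cond_eq hB (hBΩ x hx)] using hl.const_smul _⟩
  choose! g hg using hlim
  have hg_ae : ∀ᵐ x ∂(μ.restrict K), Tendsto (a · x) atTop (𝓝 (g x)) :=
    (ae_restrict_mem hK).mono hg
  refine ⟨g, aestronglyMeasurable_of_tendsto_ae atTop ha hg_ae, ?_⟩
  simpa only [ofReal_norm] using tendsto_lintegral_norm_of_dominated_convergence ha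
    (integrable_const _).2 (fun n => ae_of_all _ (haC n)) hg_ae

theorem exists_approx_of_translate [SFinite μ] [μ.IsAddLeftInvariant]
    {f : ℕ → G → ℝ} {C : ℝ} (hf : ∀ n, Measurable (f n)) (hfC : ∀ n x, ‖f n x‖ ≤ C) {B K Ω : Set G}
    (hweak : ∀ A, MeasurableSet A →
      ∃ l : ℝ, Tendsto (fun n => ∫ x in A, f n x ∂(μ.restrict Ω)) atTop (𝓝 l))
    (hK : MeasurableSet K) (hK_fin : μ K ≠ ⊤) (hB : MeasurableSet B) (hB0 : μ B ≠ 0)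
    (hB_fin : μ B ≠ ⊤) (hBΩ : ∀ x ∈ K, ∀ h ∈ B, x + h ∈ Ω) {η : ℝ≥0∞} (hη : η ≠ 0)
    (H : ∀ᶠ n in atTop, ∀ h ∈ B, ∫⁻ x in K, ‖f n (x + h) - f n x‖ₑ ∂μ ≤ η) :
    ∃ g, AEStronglyMeasurable g (μ.restrict K) ∧
      ∀ᶠ n in atTop, ∫⁻ x in K, ‖f n x - g x‖ₑ ∂μ ≤ 2 * η := by
  set ν := ProbabilityTheory.cond μ B
  have : IsProbabilityMeasure ν := ProbabilityTheory.cond_isProbabilityMeasure_of_finite hB0 hB_fin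
  let a (n : ℕ) (x : G) : ℝ := ∫ h, f n (x + h) ∂ν
  have ha (n : ℕ) : Measurable (a n) :=
    (StronglyMeasurable.integral_prod_right (f := fun x h => f n (x + h))
      ((hf n).comp measurable_add).stronglyMeasurable).measurable
  obtain ⟨g, hg, hag⟩ := exists_tendsto_integral_add_cond hf hfC hweak hK hK_fin hB hBΩ
  refine ⟨g, hg, ?_⟩
  filter_upwards [H, hag.eventually_le_const (pos_iff_ne_zero.mpr hη)] with n hn hagn
  have hfa : ∫⁻ x in K, ‖a n x - f n x‖ₑ ∂μ ≤ η :=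
    lintegral_integral_add_sub_le (hf n).stronglyMeasurable (hfC n)
      ((ProbabilityTheory.ae_cond_mem hB).mono hn)
  calc ∫⁻ x in K, ‖f n x - g x‖ₑ ∂μ
      ≤ ∫⁻ x in K, (‖a n x - f n x‖ₑ + ‖a n x - g x‖ₑ) ∂μ := lintegral_mono fun x => by
        simpa only [edist_eq_enorm_sub, enorm_sub_rev (a n x)] using
          edist_triangle (f n x) (a n x) (g x)
    _ = (∫⁻ x in K, ‖a n x - f n x‖ₑ ∂μ) + ∫⁻ x in K, ‖a n x - g x‖ₑ ∂μ :=
        lintegral_add_left ((ha n).sub (hf n)).enorm _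
    _ ≤ 2 * η := (add_le_add hfa hagn).trans_eq (two_mul η).symm

/-- A version of the compactness criterion of Kolmogorov and Riesz. -/
theorem exists_subseq_tendsto_of_translate [TopologicalSpace G] [OpensMeasurableSpace G]
    [T2Space G] [MeasurableSpace.CountablyGenerated G] [SFinite μ]
    [μ.IsAddLeftInvariant] [μ.InnerRegularCompactLTTop] {Ω : Set G} (hΩ : MeasurableSet Ω)
    (hΩ_fin : μ Ω ≠ ⊤) {f : ℕ → G → ℝ} {C : ℝ} (hf : ∀ n, Measurable (f n))
    (hfC : ∀ n x, ‖f n x‖ ≤ C)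
    (H : ∀ K, IsCompact K → K ⊆ Ω → ∀ η : ℝ≥0∞, η ≠ 0 → ∃ B : Set G,
      MeasurableSet B ∧ μ B ≠ 0 ∧ μ B ≠ ⊤ ∧ (∀ x ∈ K, ∀ h ∈ B, x + h ∈ Ω) ∧
      ∀ᶠ n in atTop, ∀ h ∈ B, ∫⁻ x in K, ‖f n (x + h) - f n x‖ₑ ∂μ ≤ η) :
    ∃ s : ℕ → ℕ, StrictMono s ∧ ∃ χ : G → ℝ, MemLp χ 1 (μ.restrict Ω) ∧
      Tendsto (fun n => eLpNorm (f (s n) - χ) 1 (μ.restrict Ω)) atTop (𝓝 0) := by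
  have : IsFiniteMeasure (μ.restrict Ω) := ⟨by simpa using hΩ_fin.lt_top⟩
  obtain ⟨s, hs, hweak⟩ := exists_subseq_tendsto_setIntegral (μ.restrict Ω)
    (fun n => (hf n).aestronglyMeasurable) fun n => ae_of_all _ (hfC n)
  refine ⟨s, hs, exists_tendsto_eLpNorm_of_forall_exists_approx
    (fun n => MemLp.of_bound (hf _).aestronglyMeasurable C (ae_of_all _ (hfC _))) fun r hr => ?_⟩
  obtain ⟨η, hη0, hη⟩ := ENNReal.exists_nnreal_pos_mul_lt (a := ENNReal.ofReal C + 2) (by simp) hr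
  have hη0' : (η : ℝ≥0∞) ≠ 0 := by exact_mod_cast hη0.ne'
  obtain ⟨K, hKΩ, hK, hKη⟩ := hΩ.exists_isCompact_sdiff_lt hΩ_fin hη0'
  obtain ⟨B, hB, hB0, hB_fin, hBΩ, hBη⟩ := H K hK hKΩ η hη0'
  obtain ⟨g, hg, hfg⟩ := exists_approx_of_translate (fun n => hf (s n)) (fun n => hfC (s n)) hweak
    hK.measurableSet (measure_ne_top_of_subset hKΩ hΩ_fin) hB hB0 hB_fin hBΩ hη0'
    (hs.tendsto_atTop.eventually hBη)
  refine ⟨K.indicator g, (aestronglyMeasurable_indicator_iff hK.measurableSet).mpr ?_, ?_⟩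
  · rwa [Measure.restrict_restrict_of_subset hKΩ]
  filter_upwards [hfg] with n hn
  rw [eLpNorm_one_eq_lintegral_enorm, ← Set.sdiff_union_of_subset hKΩ]
  calc ∫⁻ x in Ω \ K ∪ K, ‖(f (s n) - K.indicator g) x‖ₑ ∂μ
      ≤ (∫⁻ x in Ω \ K, ‖(f (s n) - K.indicator g) x‖ₑ ∂μ)
        + ∫⁻ x in K, ‖(f (s n) - K.indicator g) x‖ₑ ∂μ := lintegral_union_le _ _ _
    _ ≤ (∫⁻ _ in Ω \ K, ENNReal.ofReal C ∂μ) + ∫⁻ x in K, ‖f (s n) x - g x‖ₑ ∂μ := by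
        refine add_le_add (setLIntegral_mono' (hΩ.diff hK.measurableSet) fun x hx => ?_)
          (setLIntegral_mono' hK.measurableSet fun x hx => ?_)
        · simpa [hx.2, ← ofReal_norm] using ENNReal.ofReal_le_ofReal (hfC (s n) x)
        · simp [hx]
    _ ≤ ENNReal.ofReal C * η + 2 * η := by
        rw [setLIntegral_const]
        gcongr
    _ = η * (ENNReal.ofReal C + 2) := by ring
    _ ≤ r := hη.le

end Translation
theorem tendsto_setLIntegral_enorm_zero_of_isCompact {α F : Type*} [MeasurableSpace α]
    [TopologicalSpace α] [OpensMeasurableSpace α] [T2Space α] [NormedAddCommGroup F]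
    {μ : Measure α} [μ.InnerRegularCompactLTTop] {Ω : Set α} (hΩ : MeasurableSet Ω)
    (hΩ_fin : μ Ω ≠ ⊤) {ι : Type*} {l : Filter ι} {g : ι → α → F} {C : ℝ≥0∞} (hC : C ≠ ⊤)
    (hgC : ∀ i x, ‖g i x‖ₑ ≤ C)
    (H : ∀ K, IsCompact K → K ⊆ Ω → Tendsto (fun i => ∫⁻ x in K, ‖g i x‖ₑ ∂μ) l (𝓝 0)) :
    Tendsto (fun i => ∫⁻ x in Ω, ‖g i x‖ₑ ∂μ) l (𝓝 0) := by
  rw [ENNReal.tendsto_nhds_zero]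
  intro r hr
  obtain ⟨η, hη0, hη⟩ := ENNReal.exists_nnreal_pos_mul_lt (a := C + 1) (by simp [hC]) hr.ne'
  have hη0' : (0 : ℝ≥0∞) < η := by exact_mod_cast hη0
  obtain ⟨K, hKΩ, hK, hKη⟩ := hΩ.exists_isCompact_sdiff_lt hΩ_fin hη0'.ne'
  filter_upwards [(H K hK hKΩ).eventually_le_const hη0'] with i hi
  calc ∫⁻ x in Ω, ‖g i x‖ₑ ∂μ
      = ∫⁻ x in Ω \ K ∪ K, ‖g i x‖ₑ ∂μ := by rw [Set.sdiff_union_of_subset hKΩ]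
    _ ≤ (∫⁻ x in Ω \ K, ‖g i x‖ₑ ∂μ) + ∫⁻ x in K, ‖g i x‖ₑ ∂μ := lintegral_union_le _ _ _
    _ ≤ (∫⁻ _ in Ω \ K, C ∂μ) + ∫⁻ x in K, ‖g i x‖ₑ ∂μ := by
        gcongr
        exact hgC i _
    _ ≤ C * η + η := by
        rw [setLIntegral_const]
        gcongr
    _ = η * (C + 1) := by ring
    _ ≤ r := hη.le

theorem ae_mem_of_tendsto_eLpNorm {α F : Type*} [MeasurableSpace α] {μ : Measure α}
    [NormedAddCommGroup F] {p : ℝ≥0∞} (hp : p ≠ 0) {f : ℕ → α → F} {χ : α → F} {S : Set F}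
    (hS : IsClosed S) (hf : ∀ n, AEStronglyMeasurable (f n) μ) (hfS : ∀ n, ∀ᵐ x ∂μ, f n x ∈ S)
    (hχ : AEStronglyMeasurable χ μ) (hlim : Tendsto (fun n => eLpNorm (f n - χ) p μ) atTop (𝓝 0)) :
    ∀ᵐ x ∂μ, χ x ∈ S := by
  obtain ⟨s, -, hs⟩ := (tendstoInMeasure_of_tendsto_eLpNorm hp hf hχ hlim).exists_seq_tendsto_ae
  filter_upwards [hs, ae_all_iff.mpr hfS] with x hx hxS
  exact hS.mem_of_tendsto hx (.of_forall fun n => hxS (s n))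

/-! ### Variation bounds from translation estimates -/

theorem tendsto_integral_mul {α : Type*} [MeasurableSpace α] {μ : Measure α} {f q : ℕ → α → ℝ}
    {χ D : α → ℝ} {L : ℝ} (hf : ∀ n, AEStronglyMeasurable (f n) μ) (hχ : Integrable χ μ)
    (hlim : Tendsto (fun n => eLpNorm (f n - χ) 1 μ) atTop (𝓝 0))
    (hq : ∀ n, AEStronglyMeasurable (q n) μ) (hqL : ∀ n, ∀ᵐ x ∂μ, ‖q n x‖ ≤ L)
    (hqD : ∀ᵐ x ∂μ, Tendsto (q · x) atTop (𝓝 (D x))) :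
    Tendsto (fun n => ∫ x, f n x * q n x ∂μ) atTop (𝓝 (∫ x, χ x * D x ∂μ)) := by
  have hχq (n : ℕ) : Integrable (fun x => χ x * q n x) μ := hχ.mul_bdd (hq n) (hqL n)
  have hdom : Tendsto (fun n => ∫ x, χ x * q n x ∂μ) atTop (𝓝 (∫ x, χ x * D x ∂μ)) := by
    refine tendsto_integral_of_dominated_convergence (fun x => ‖χ x‖ * L) (fun n => (hχq n).1)
      (hχ.norm.mul_const L) (fun n => ?_) ?_
    · filter_upwards [hqL n] with x hx
      rw [norm_mul]
      gcongr
    · filter_upwards [hqD] with x hx using hx.const_mul _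
  have hfχ : ∀ᶠ n in atTop, Integrable (fun x => (f n - χ) x * q n x) μ := by
    filter_upwards [hlim.eventually_lt_const ENNReal.zero_lt_top] with n hn
    exact (memLp_one_iff_integrable.mp ⟨(hf n).sub hχ.1, hn⟩).mul_bdd (hq n) (hqL n)
  have hsmall : Tendsto (fun n => ∫ x, (f n - χ) x * q n x ∂μ) atTop (𝓝 0) := by
    have hbound : Tendsto (fun n => eLpNorm (f n - χ) 1 μ * ENNReal.ofReal L) atTop (𝓝 0) := by
      simpa using ENNReal.Tendsto.mul_const hlim (.inr ENNReal.ofReal_ne_top)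
    rw [tendsto_zero_iff_enorm_tendsto_zero]
    refine tendsto_of_tendsto_of_tendsto_of_le_of_le tendsto_const_nhds hbound
      (fun _ => zero_le) fun n => ?_
    refine (enorm_integral_le_lintegral_enorm _).trans ?_
    rw [eLpNorm_one_eq_lintegral_enorm, ← lintegral_mul_const' _ _ ENNReal.ofReal_ne_top]
    refine lintegral_mono_ae ((hqL n).mono fun x hx => ?_)
    rw [enorm_mul, ← ofReal_norm (q n x)]
    gcongr
  refine (add_zero (∫ x, χ x * D x ∂μ) ▸ hdom.add hsmall).congr' ?_
  filter_upwards [hfχ] with n hn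
  rw [← integral_add (hχq n) hn]
  exact integral_congr_ae (ae_of_all _ fun x => by simp only [Pi.sub_apply]; ring)

theorem integral_mul_shift_sub {G : Type*} [AddGroup G] [MeasurableSpace G] [MeasurableAdd G]
    {μ : Measure G} [μ.IsAddRightInvariant] {f ψ : G → ℝ} {h : G}
    (hfψ : Integrable (fun x => f x * ψ x) μ) (hfψh : Integrable (fun x => f x * ψ (x - h)) μ) :
    ∫ x, f x * (ψ (x - h) - ψ x) ∂μ = ∫ x, (f (x + h) - f x) * ψ x ∂μ := by
  have hshift : Integrable (fun x => f (x + h) * ψ x) μ := by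
    simpa using hfψh.comp_add_right h
  have heq : ∫ x, f x * ψ (x - h) ∂μ = ∫ x, f (x + h) * ψ x ∂μ := by
    rw [← integral_add_right_eq_self _ h]
    simp
  simp only [mul_sub, sub_mul]
  rw [integral_sub hfψh hfψ, integral_sub hshift hfψ, heq]

theorem enorm_integral_mul_le_of_enorm_le {α : Type*} [MeasurableSpace α] [TopologicalSpace α]
    {μ : Measure α} {g ψ : α → ℝ} {B : ℝ≥0∞} (hg : AEStronglyMeasurable g μ)
    (hψ : ∀ x, ‖ψ x‖ₑ ≤ B) :
    ‖∫ x, g x * ψ x ∂μ‖ₑ ≤ (∫⁻ x in tsupport ψ, ‖g x‖ₑ ∂μ) * B :=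
  calc ‖∫ x, g x * ψ x ∂μ‖ₑ
      ≤ ∫⁻ x, ‖g x * ψ x‖ₑ ∂μ := enorm_integral_le_lintegral_enorm _
    _ = ∫⁻ x in tsupport ψ, ‖g x * ψ x‖ₑ ∂μ := by
        refine (setLIntegral_eq_of_support_subset fun x hx => subset_tsupport ψ fun h => hx ?_).symm
        simp [h]
    _ ≤ ∫⁻ x in tsupport ψ, ‖g x‖ₑ * B ∂μ := lintegral_mono fun x => by
        rw [enorm_mul]
        gcongr
        exact hψ x
    _ = (∫⁻ x in tsupport ψ, ‖g x‖ₑ ∂μ) * B := lintegral_mul_const'' _ hg.restrict.enorm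

theorem exists_pos_forall_closedBall_subset {X : Type*} [PseudoMetricSpace X] {K Ω : Set X}
    (hK : IsCompact K) (hΩ : IsOpen Ω) (hKΩ : K ⊆ Ω) :
    ∃ δ > 0, ∀ x ∈ K, Metric.closedBall x δ ⊆ Ω :=
  let ⟨δ, hδ, h⟩ := hK.exists_cthickening_subset_open hΩ hKΩ
  ⟨δ, hδ, fun _ hx => (Metric.closedBall_subset_cthickening hx δ).trans h⟩

theorem enorm_setIntegral_mul_shift_sub_le {E : Type*} [NormedAddCommGroup E] [MeasurableSpace E]
    [BorelSpace E] [SecondCountableTopology E] {μ : Measure E} [μ.IsAddRightInvariant] {Ω : Set E}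
    {f ψ : E → ℝ} {B : ℝ≥0∞} (hf : LocallyIntegrable f μ) (hψ : Continuous ψ)
    (hψ_supp : HasCompactSupport ψ) (hψB : ∀ x, ‖ψ x‖ₑ ≤ B) {h : E}
    (hΩ : ∀ x ∈ tsupport ψ, Metric.closedBall x ‖h‖ ⊆ Ω) :
    ‖∫ x in Ω, f x * (ψ (x - h) - ψ x) ∂μ‖ₑ ≤
      (∫⁻ x in tsupport ψ, ‖f (x + h) - f x‖ₑ ∂μ) * B := by
  have hψh : HasCompactSupport fun x => ψ (x - h) :=
    hψ_supp.comp_homeomorph (Homeomorph.subRight h)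
  have hψh_cont : Continuous fun x => ψ (x - h) := hψ.comp (continuous_sub_right h)
  have hΩ_compl : ∀ x ∉ Ω, f x * (ψ (x - h) - ψ x) = 0 := fun x hx => by
    have hψx : ψ x = 0 := image_eq_zero_of_notMem_tsupport fun h' =>
      hx (hΩ x h' (Metric.mem_closedBall_self (norm_nonneg h)))
    have hψxh : ψ (x - h) = 0 := image_eq_zero_of_notMem_tsupport fun h' =>
      hx (hΩ _ h' (by simp))
    rw [hψx, hψxh, sub_zero, mul_zero]
  rw [setIntegral_eq_integral_of_forall_compl_eq_zero hΩ_compl, integral_mul_shift_sub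
    (hf.integrable_smul_right_of_hasCompactSupport hψ hψ_supp)
    (hf.integrable_smul_right_of_hasCompactSupport hψh_cont hψh)]
  exact enorm_integral_mul_le_of_enorm_le
    ((hf.aestronglyMeasurable.comp_measurePreserving (measurePreserving_add_right μ h)).sub
      hf.aestronglyMeasurable) hψB

section Derivative

variable {E : Type*} [NormedAddCommGroup E] [NormedSpace ℝ E] [MeasurableSpace E] [BorelSpace E]
  {μ : Measure E} {Ω : Set E} {f : ℕ → E → ℝ} {χ ψ : E → ℝ} {ε : ℕ → ℝ}

theorem tendsto_setIntegral_mul_slope (hf : ∀ n, AEStronglyMeasurable (f n) (μ.restrict Ω))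
    (hχ : IntegrableOn χ Ω μ)
    (hlim : Tendsto (fun n => eLpNorm (f n - χ) 1 (μ.restrict Ω)) atTop (𝓝 0))
    (hε_pos : ∀ n, 0 < ε n) (hε : Tendsto ε atTop (𝓝 0)) (hψ : ContDiff ℝ 1 ψ)
    (hψ_supp : HasCompactSupport ψ) (e : E) :
    Tendsto (fun n => ∫ x in Ω, f n x * ((-ε n)⁻¹ • (ψ (x + -ε n • e) - ψ x)) ∂μ) atTop
      (𝓝 (∫ x in Ω, χ x * fderiv ℝ ψ x e ∂μ)) := by
  obtain ⟨L, hL⟩ := hψ.lipschitzWith_of_hasCompactSupport hψ_supp one_ne_zero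
  have hne (n : ℕ) : -ε n ≠ 0 := neg_ne_zero.mpr (hε_pos n).ne'
  refine tendsto_integral_mul (L := L * ‖e‖) hf hχ hlim (fun n => ?_)
    (fun n => ae_of_all _ fun x => ?_) (ae_of_all _ fun x => ?_)
  · have := hψ.continuous
    exact (by fun_prop : Continuous _).aestronglyMeasurable
  · rw [norm_smul, norm_inv, inv_mul_le_iff₀ (norm_pos_iff.mpr (hne n))]
    calc ‖ψ (x + -ε n • e) - ψ x‖ ≤ L * ‖x + -ε n • e - x‖ := hL.norm_sub_le _ _
      _ = ‖-ε n‖ * (L * ‖e‖) := by rw [add_sub_cancel_left, norm_smul]; ring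
  · refine ((hψ.differentiable one_ne_zero x).hasFDerivAt.hasLineDerivAt e).tendsto_slope_zero.comp
      (tendsto_nhdsWithin_iff.mpr ⟨by simpa using hε.neg, .of_forall hne⟩)

theorem enorm_setIntegral_mul_fderiv_le [SecondCountableTopology E] [μ.IsAddRightInvariant]
    (hΩ : IsOpen Ω) (hf : ∀ n, LocallyIntegrable (f n) μ) (hχ : IntegrableOn χ Ω μ)
    (hlim : Tendsto (fun n => eLpNorm (f n - χ) 1 (μ.restrict Ω)) atTop (𝓝 0))
    (hε_pos : ∀ n, 0 < ε n) (hε : Tendsto ε atTop (𝓝 0)) {e : E} {M : ℝ≥0∞}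
    (H : ∀ K, IsCompact K → K ⊆ Ω → ∀ᶠ n in atTop,
      ∫⁻ x in K, ‖f n (x + ε n • e) - f n x‖ₑ ∂μ ≤ ENNReal.ofReal (ε n) * M)
    (hψ : ContDiff ℝ 1 ψ) (hψ_supp : HasCompactSupport ψ) (hψΩ : tsupport ψ ⊆ Ω) {B : ℝ≥0∞}
    (hψB : ∀ x, ‖ψ x‖ₑ ≤ B) :
    ‖∫ x in Ω, χ x * fderiv ℝ ψ x e ∂μ‖ₑ ≤ M * B := by
  obtain ⟨δ, hδ, hball⟩ := exists_pos_forall_closedBall_subset hψ_supp.isCompact hΩ hψΩ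
  have hsmall : ∀ᶠ n in atTop, ‖ε n • e‖ ≤ δ :=
    (hε.smul_const e).norm.eventually_le_const (by simpa using hδ)
  refine le_of_tendsto (tendsto_setIntegral_mul_slope
    (fun n => (hf n).aestronglyMeasurable.restrict) hχ hlim hε_pos hε hψ hψ_supp e).enorm ?_
  filter_upwards [hsmall, H _ hψ_supp.isCompact hψΩ] with n hn hfn
  calc ‖∫ x in Ω, f n x * ((-ε n)⁻¹ • (ψ (x + -ε n • e) - ψ x)) ∂μ‖ₑ
      = ‖(-ε n)⁻¹‖ₑ * ‖∫ x in Ω, f n x * (ψ (x - ε n • e) - ψ x) ∂μ‖ₑ := by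
        simp only [smul_eq_mul, mul_left_comm (f n _), integral_const_mul, enorm_mul, neg_smul,
          ← sub_eq_add_neg]
    _ ≤ ‖(-ε n)⁻¹‖ₑ * ((ENNReal.ofReal (ε n) * M) * B) := by
        gcongr
        exact (enorm_setIntegral_mul_shift_sub_le (hf n) hψ.continuous hψ_supp hψB fun x hx =>
          (Metric.closedBall_subset_closedBall hn).trans (hball x hx)).trans (by gcongr)
    _ = M * B := by
        rw [enorm_inv (neg_ne_zero.mpr (hε_pos n).ne'), enorm_neg,
          Real.enorm_of_nonneg (hε_pos n).le, mul_assoc,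
          ENNReal.inv_mul_cancel_left (by simpa using hε_pos n) ENNReal.ofReal_ne_top]

end Derivative

theorem divergence_eq_sum_repr (b : Module.Basis (Fin 2) ℝ Plane) (φ : Plane → Plane) (x : Plane) :
    divergence φ x = ∑ i, b.repr (fderiv ℝ φ x (b i)) i := by
  have htrace (b : Module.Basis (Fin 2) ℝ Plane) :
      LinearMap.trace ℝ Plane (fderiv ℝ φ x) = ∑ i, b.repr (fderiv ℝ φ x (b i)) i := by
    simp [LinearMap.trace_eq_matrix_trace ℝ b, Matrix.trace, LinearMap.toMatrix_apply]
  rw [← htrace, htrace (EuclideanSpace.basisFun (Fin 2) ℝ).toBasis]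
  simp [divergence]

theorem totalVariation_lt_top {Ω : Set Plane} {χ : Plane → ℝ} (hχ : IntegrableOn χ Ω)
    (b : Module.Basis (Fin 2) ℝ Plane) {M : ℝ≥0∞} (hM : M ≠ ⊤)
    (H : ∀ i, ∀ ψ : Plane → ℝ, ContDiff ℝ 1 ψ → HasCompactSupport ψ → tsupport ψ ⊆ Ω →
      ∀ B : ℝ≥0∞, (∀ x, ‖ψ x‖ₑ ≤ B) → ‖∫ x in Ω, χ x * fderiv ℝ ψ x (b i)‖ₑ ≤ M * B) :
    totalVariation χ Ω < ⊤ := by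
  set c : Fin 2 → Plane →L[ℝ] ℝ := fun i => LinearMap.toContinuousLinearMap (b.coord i)
  refine lt_of_le_of_lt (iSup₂_le fun φ ⟨hφ, hφ_supp, hφΩ, hφ_le⟩ => ?_)
    (ENNReal.sum_lt_top.mpr fun i (_ : i ∈ Finset.univ) => ENNReal.mul_lt_top hM.lt_top
      (enorm_lt_top (x := c i)))
  have hcφ (i : Fin 2) : ContDiff ℝ 1 (c i ∘ φ) := (c i).contDiff.comp hφ
  have hcφ_supp (i : Fin 2) : HasCompactSupport (c i ∘ φ) := hφ_supp.comp_left (map_zero (c i))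
  have hcφ_le (i : Fin 2) (x : Plane) : ‖(c i ∘ φ) x‖ₑ ≤ ‖c i‖ₑ :=
    ((c i).le_opENorm _).trans (mul_le_of_le_one_right' (by simpa [← ofReal_norm] using hφ_le x))
  have hdiv (x : Plane) : divergence φ x = ∑ i, fderiv ℝ (c i ∘ φ) x (b i) := by
    rw [divergence_eq_sum_repr b]
    refine Finset.sum_congr rfl fun i _ => ?_
    rw [fderiv_comp x (c i).differentiableAt (hφ.differentiable one_ne_zero x), (c i).fderiv]
    rfl
  have hint (i : Fin 2) : IntegrableOn (fun x => χ x * fderiv ℝ (c i ∘ φ) x (b i)) Ω := by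
    have hcont : Continuous fun x => fderiv ℝ (c i ∘ φ) x (b i) :=
      ((hcφ i).continuous_fderiv one_ne_zero).clm_apply continuous_const
    obtain ⟨C, hC⟩ := hcont.bounded_above_of_compact_support ((hcφ_supp i).fderiv_apply ℝ (b i))
    exact hχ.mul_bdd hcont.aestronglyMeasurable (ae_of_all _ hC)
  calc ENNReal.ofReal (∫ x in Ω, χ x * divergence φ x)
      ≤ ‖∑ i, ∫ x in Ω, χ x * fderiv ℝ (c i ∘ φ) x (b i)‖ₑ := by
        simp only [hdiv, Finset.mul_sum]
        rw [integral_finsetSum _ fun i _ => hint i]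
        exact Real.ofReal_le_enorm _
    _ ≤ ∑ i, ‖∫ x in Ω, χ x * fderiv ℝ (c i ∘ φ) x (b i)‖ₑ := enorm_sum_le _ _
    _ ≤ ∑ i, M * ‖c i‖ₑ := Finset.sum_le_sum fun i _ =>
        H i _ (hcφ i) (hcφ_supp i) ((tsupport_comp_subset (map_zero (c i)) φ).trans hφΩ) _
          (hcφ_le i)

/-! ### Estimates for the sign fields -/

theorem lintegral_enorm_sub_le_sum {α E : Type*} [MeasurableSpace α] {μ : Measure α}
    [NormedAddCommGroup E] {g : ℕ → α → E} (hg : ∀ k, AEStronglyMeasurable (g k) μ) (N : ℕ) :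
    ∫⁻ x, ‖g N x - g 0 x‖ₑ ∂μ ≤ ∑ k ∈ Finset.range N, ∫⁻ x, ‖g (k + 1) x - g k x‖ₑ ∂μ := by
  have h_meas (k : ℕ) : AEMeasurable (fun x => ‖g (k + 1) x - g k x‖ₑ) μ :=
    ((hg (k + 1)).sub (hg k)).enorm
  rw [← lintegral_finsetSum' _ fun k _ => h_meas k]
  refine lintegral_mono fun x => ?_
  rw [← Finset.sum_range_sub fun k => g k x]
  exact enorm_sum_le _ _

section SignField

variable {ε : ℝ} (u : SpinField ε)

/-- The field whose value on each parallelogram of the lattice `ε ℒ` is the sign attached to it.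
Unlike the chirality it takes only the values `-1` and `1`. -/
def signField (x : Plane) : ℝ := cellSign u (cell ε x)

theorem measurable_signField : Measurable (signField u) :=
  (measurable_of_countable (cellSign u)).comp (measurable_cell ε)

theorem signField_mem (x : Plane) : signField u x ∈ ({-1, 1} : Set ℝ) :=
  pmSign_eq_neg_one_or_one _

theorem norm_signField (x : Plane) : ‖signField u x‖ = 1 := abs_pmSign _

theorem locallyIntegrable_signField : LocallyIntegrable (signField u) :=
  (locallyIntegrable_const (1 : ℝ)).mono (measurable_signField u).aestronglyMeasurable
    (ae_of_all _ fun x => by rw [norm_signField, norm_one])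

theorem norm_chirality_le_one (x : Plane) : ‖chirality u x‖ ≤ 1 := by
  have h_triangle (T : Triangle) : ‖triangleChirality u T‖ ≤ 1 := by
    obtain ⟨h, p, hT⟩ := T.exists_isFace
    rw [hT.triangleChirality_eq, Real.norm_eq_abs, faceChirality]
    exact abs_spinChirality_le_one (norm_spinAt u _) (norm_spinAt u _) (norm_spinAt u _)
  rw [chirality]
  split_ifs
  · exact h_triangle _
  · rw [norm_zero]
    exact zero_le_one

theorem aestronglyMeasurable_chirality (hε : 0 < ε) :
    AEStronglyMeasurable (chirality u) := by
  have h_face : Measurable (Function.uncurry (faceChirality u)) := measurable_of_countable _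
  have h_meas := h_face.comp ((measurable_half ε).prodMk (measurable_cell ε))
  exact ⟨_, h_meas.stronglyMeasurable, ae_chirality_eq u hε⟩

theorem integrableOn_chirality (hε : 0 < ε) {Ω : Set Plane} (hΩ_fin : volume Ω ≠ ⊤) :
    IntegrableOn (chirality u) Ω :=
  .of_bound hΩ_fin.lt_top (aestronglyMeasurable_chirality u hε).restrict 1
    (ae_of_all _ (norm_chirality_le_one u))

variable {u} {A Ω : Set Plane}

theorem lintegral_cellExcess_add_le (hε : 0 < ε) {v : Plane}
    (hA : ∀ x ∈ A, Metric.closedBall (x + v) (2 * ε) ⊆ Ω) :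
    ∫⁻ x in A, cellExcess u (cell ε (x + v)) ≤ 16 * ENNReal.ofReal ε * energy u Ω := by
  refine ((measurePreserving_add_right volume v).setLIntegral_comp_emb
    (measurableEmbedding_addRight v) (fun y => cellExcess u (cell ε y)) A).trans_le ?_
  exact lintegral_cellExcess_le u hε (Set.forall_mem_image.mpr hA)

theorem lintegral_chirality_sub_signField_le (hε : 0 < ε)
    (hA : ∀ x ∈ A, Metric.closedBall x (2 * ε) ⊆ Ω) :
    ∫⁻ x in A, ‖chirality u x - signField u x‖ₑ ≤ 112 * ENNReal.ofReal ε * energy u Ω := by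
  calc ∫⁻ x in A, ‖chirality u x - signField u x‖ₑ
      ≤ ∫⁻ x in A, 7 * cellExcess u (cell ε x) :=
        lintegral_mono_ae <| ae_restrict_of_ae <| (ae_chirality_eq u hε).mono fun x hx => by
          rw [hx]
          exact enorm_faceChirality_sub_cellSign_le u _ _
    _ = 7 * ∫⁻ x in A, cellExcess u (cell ε x) := lintegral_const_mul' _ _ (by simp)
    _ ≤ 7 * (16 * ENNReal.ofReal ε * energy u Ω) := by
        gcongr
        exact lintegral_cellExcess_le u hε hA
    _ = 112 * ENNReal.ofReal ε * energy u Ω := by ring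

theorem cell_add_smul (t : ℝ) (x : Plane) (i : Fin 2) :
    cell ε (x + t • latticeBasis i)
      = cell ε x + Pi.single i (⌊relCoord ε x i + t / ε⌋ - ⌊relCoord ε x i⌋) := by
  ext j
  by_cases hj : j = i
  · subst hj
    simp [cell, relCoord, add_div]
  · simp [cell, relCoord, hj, Finsupp.single_eq_of_ne hj]

theorem cell_add_smul_self (hε : 0 < ε) (x : Plane) (i : Fin 2) :
    cell ε (x + ε • latticeBasis i) = cell ε x + Pi.single i 1 := by
  rw [cell_add_smul, div_self hε.ne', Int.floor_add_one, add_sub_cancel_left]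

theorem cell_add_smul_eq_or (hε : 0 < ε) {t : ℝ} (ht : 0 ≤ t) (htε : t ≤ ε) (x : Plane)
    (i : Fin 2) :
    cell ε (x + t • latticeBasis i) = cell ε x ∨
      cell ε (x + t • latticeBasis i) = cell ε x + Pi.single i 1 := by
  have h_ge : ⌊relCoord ε x i⌋ ≤ ⌊relCoord ε x i + t / ε⌋ :=
    Int.floor_mono (le_add_of_nonneg_right (div_nonneg ht hε.le))
  have h_le : ⌊relCoord ε x i + t / ε⌋ ≤ ⌊relCoord ε x i⌋ + 1 := by
    rw [← Int.floor_add_one]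
    exact Int.floor_mono (add_le_add_right ((div_le_one hε).mpr htε) _)
  rw [cell_add_smul]
  obtain h | h : ⌊relCoord ε x i + t / ε⌋ - ⌊relCoord ε x i⌋ = 0 ∨
      ⌊relCoord ε x i + t / ε⌋ - ⌊relCoord ε x i⌋ = 1 := by lia
  · exact .inl (by rw [h, Pi.single_zero, add_zero])
  · exact .inr (by rw [h])

theorem enorm_signField_add_smul_sub_le (hε : 0 < ε) {t : ℝ} (ht : 0 ≤ t) (htε : t ≤ ε)
    (x : Plane) (i : Fin 2) :
    ‖signField u (x + t • latticeBasis i) - signField u x‖ₑ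
      ≤ 10 * (cellExcess u (cell ε x) + cellExcess u (cell ε (x + ε • latticeBasis i))) := by
  rw [cell_add_smul_self hε, signField, signField]
  obtain h | h := cell_add_smul_eq_or hε ht htε x i
  · simp [h]
  · rw [h]
    exact enorm_cellSign_add_single_sub_le u i _

theorem lintegral_signField_add_sub_le_of_le (hε : 0 < ε) {t : ℝ} (ht : 0 ≤ t) (htε : t ≤ ε)
    {v : Plane} (hA : ∀ x ∈ A, Metric.closedBall (x + v) (3 * ε) ⊆ Ω) (i : Fin 2) :
    ∫⁻ x in A, ‖signField u (x + (v + t • latticeBasis i)) - signField u (x + v)‖ₑ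
      ≤ 320 * ENNReal.ofReal ε * energy u Ω := by
  have h_meas (w : Plane) : Measurable fun x => cellExcess u (cell ε (x + w)) :=
    (measurable_of_countable (cellExcess u)).comp
      ((measurable_cell ε).comp (measurable_add_const w))
  have h_near (x : Plane) (hx : x ∈ A) : Metric.closedBall (x + v) (2 * ε) ⊆ Ω :=
    (Metric.closedBall_subset_closedBall (by linarith)).trans (hA x hx)
  have h_far (x : Plane) (hx : x ∈ A) :
      Metric.closedBall (x + (v + ε • latticeBasis i)) (2 * ε) ⊆ Ω := by
    refine (Metric.closedBall_subset_closedBall' ?_).trans (hA x hx)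
    rw [← add_assoc, dist_eq_norm, add_sub_cancel_left, norm_smul_latticeBasis,
      abs_of_pos hε]
    linarith
  calc ∫⁻ x in A, ‖signField u (x + (v + t • latticeBasis i)) - signField u (x + v)‖ₑ
      ≤ ∫⁻ x in A, 10 * (cellExcess u (cell ε (x + v))
          + cellExcess u (cell ε (x + (v + ε • latticeBasis i)))) :=
        lintegral_mono fun x => by
          simpa only [add_assoc] using enorm_signField_add_smul_sub_le hε ht htε (x + v) i
    _ = 10 * ((∫⁻ x in A, cellExcess u (cell ε (x + v)))
          + ∫⁻ x in A, cellExcess u (cell ε (x + (v + ε • latticeBasis i)))) := by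
        rw [lintegral_const_mul' _ _ (by simp), lintegral_add_left (h_meas v)]
    _ ≤ 10 * (16 * ENNReal.ofReal ε * energy u Ω + 16 * ENNReal.ofReal ε * energy u Ω) := by
        gcongr
        · exact lintegral_cellExcess_add_le hε h_near
        · exact lintegral_cellExcess_add_le hε h_far
    _ = 320 * ENNReal.ofReal ε * energy u Ω := by ring

theorem lintegral_signField_add_natCast_mul_smul_sub_le (hε : 0 < ε) {s : ℝ} (hs : 0 ≤ s)
    (hsε : s ≤ ε) (N : ℕ) {v : Plane}
    (hA : ∀ x ∈ A, Metric.closedBall (x + v) (N * s + 3 * ε) ⊆ Ω) (i : Fin 2) :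
    ∫⁻ x in A, ‖signField u (x + (v + (N * s) • latticeBasis i)) - signField u (x + v)‖ₑ
      ≤ N * (320 * ENNReal.ofReal ε * energy u Ω) := by
  let w (k : ℕ) : Plane := v + (k * s) • latticeBasis i
  have hw_succ (k : ℕ) : w (k + 1) = w k + s • latticeBasis i := by
    simp only [w, add_assoc, ← add_smul]
    push_cast
    ring_nf
  have hw_zero : w 0 = v := by simp [w]
  have h_step (k : ℕ) (hk : k < N) :
      ∫⁻ x in A, ‖signField u (x + w (k + 1)) - signField u (x + w k)‖ₑ
        ≤ 320 * ENNReal.ofReal ε * energy u Ω := by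
    rw [hw_succ]
    refine lintegral_signField_add_sub_le_of_le hε hs hsε (fun x hx => ?_) i
    refine (Metric.closedBall_subset_closedBall' ?_).trans (hA x hx)
    rw [dist_eq_norm, add_sub_add_left_eq_sub, add_sub_cancel_left, norm_smul_latticeBasis,
      abs_of_nonneg (by positivity), add_comm]
    gcongr
  calc ∫⁻ x in A, ‖signField u (x + w N) - signField u (x + v)‖ₑ
      ≤ ∑ k ∈ Finset.range N,
          ∫⁻ x in A, ‖signField u (x + w (k + 1)) - signField u (x + w k)‖ₑ := by
        simpa only [hw_zero] using
          lintegral_enorm_sub_le_sum (g := fun k x => signField u (x + w k)) (fun k =>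
            ((measurable_signField u).comp (measurable_add_const _)).aestronglyMeasurable) N
    _ ≤ ∑ k ∈ Finset.range N, 320 * ENNReal.ofReal ε * energy u Ω :=
        Finset.sum_le_sum fun k hk => h_step k (Finset.mem_range.mp hk)
    _ = N * (320 * ENNReal.ofReal ε * energy u Ω) := by
        rw [Finset.sum_const, Finset.card_range, nsmul_eq_mul]

theorem lintegral_signField_add_smul_sub_le (hε : 0 < ε) {t : ℝ} (ht : 0 ≤ t) {v : Plane}
    (hA : ∀ x ∈ A, Metric.closedBall (x + v) (t + 3 * ε) ⊆ Ω) (i : Fin 2) :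
    ∫⁻ x in A, ‖signField u (x + (v + t • latticeBasis i)) - signField u (x + v)‖ₑ
      ≤ ENNReal.ofReal (t + ε) * (320 * energy u Ω) := by
  set N := ⌊t / ε⌋₊ + 1 with hN
  have hNε : N * ε ≤ t + ε := by
    have := Nat.floor_le (div_nonneg ht hε.le)
    rw [le_div_iff₀ hε] at this
    push_cast [hN]
    linarith
  have htN : t / N ≤ ε := by
    rw [div_le_iff₀ (by positivity), mul_comm, ← div_le_iff₀ hε]
    exact_mod_cast (Nat.lt_floor_add_one (t / ε)).le
  have hN_mul : N * (t / N) = t := mul_div_cancel₀ _ (by positivity)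
  calc ∫⁻ x in A, ‖signField u (x + (v + t • latticeBasis i)) - signField u (x + v)‖ₑ
      ≤ N * (320 * ENNReal.ofReal ε * energy u Ω) := by
        simpa only [hN_mul] using lintegral_signField_add_natCast_mul_smul_sub_le hε
          (div_nonneg ht N.cast_nonneg) htN N (by rwa [hN_mul]) i
    _ = ENNReal.ofReal (N * ε) * (320 * energy u Ω) := by
        rw [ENNReal.ofReal_mul (by positivity), ENNReal.ofReal_natCast]
        ring
    _ ≤ ENNReal.ofReal (t + ε) * (320 * energy u Ω) := by gcongr

/-- The open parallelogram spanned by `r ê₁` and `r ê₂`. -/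
def openParallelogram (r : ℝ) : Set Plane := {h | ∀ i, latticeBasis.repr h i ∈ Set.Ioo 0 r}

theorem isOpen_openParallelogram (r : ℝ) : IsOpen (openParallelogram r) := by
  simp only [openParallelogram, Set.ofPred_forall]
  exact isOpen_iInter_of_finite fun i =>
    isOpen_Ioo.preimage (latticeBasis.coord i).continuous_of_finiteDimensional

theorem openParallelogram_nonempty {r : ℝ} (hr : 0 < r) : (openParallelogram r).Nonempty := by
  refine ⟨∑ i, (r / 2) • latticeBasis i, fun i => ?_⟩
  rw [latticeBasis.repr_sum_self]
  exact ⟨half_pos hr, half_lt_self hr⟩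

theorem norm_le_of_mem_openParallelogram {r : ℝ} {h : Plane} (hh : h ∈ openParallelogram r) :
    ‖h‖ ≤ 2 * r := by
  refine norm_le_of_forall_abs_repr_le fun i => ?_
  rw [abs_of_pos (hh i).1]
  exact (hh i).2.le

theorem lintegral_signField_add_sub_le (hε : 0 < ε) {r : ℝ} (hεr : ε ≤ r)
    (hA : ∀ x ∈ A, Metric.closedBall x (5 * r) ⊆ Ω) {h : Plane} (hh : h ∈ openParallelogram r) :
    ∫⁻ x in A, ‖signField u (x + h) - signField u x‖ₑ
      ≤ ENNReal.ofReal r * (1280 * energy u Ω) := by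
  set c := latticeBasis.repr h
  have h_sum : h = c 0 • latticeBasis 0 + c 1 • latticeBasis 1 := by
    rw [← Fin.sum_univ_two fun i => c i • latticeBasis i, latticeBasis.sum_repr]
  have h_along (v : Plane) (hv : ‖v‖ ≤ r) (i : Fin 2) :
      ∫⁻ x in A, ‖signField u (x + (v + c i • latticeBasis i)) - signField u (x + v)‖ₑ
        ≤ ENNReal.ofReal (2 * r) * (320 * energy u Ω) := by
    have h_ball (x : Plane) (hx : x ∈ A) : Metric.closedBall (x + v) (c i + 3 * ε) ⊆ Ω := by
      refine (Metric.closedBall_subset_closedBall' ?_).trans (hA x hx)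
      rw [dist_eq_norm, add_sub_cancel_left]
      linarith [(hh i).2]
    refine (lintegral_signField_add_smul_sub_le hε (hh i).1.le h_ball i).trans ?_
    gcongr
    linarith [(hh i).2]
  have h_first : ‖c 0 • latticeBasis 0‖ ≤ r := by
    rw [norm_smul_latticeBasis, abs_of_pos (hh 0).1]
    exact (hh 0).2.le
  have h_zero : ∫⁻ x in A, ‖signField u (x + c 0 • latticeBasis 0) - signField u x‖ₑ
      ≤ ENNReal.ofReal (2 * r) * (320 * energy u Ω) := by
    simpa only [zero_add, add_zero] using h_along 0 (norm_zero.trans_le (hε.le.trans hεr)) 0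
  have h_one := h_along (c 0 • latticeBasis 0) h_first 1
  rw [← h_sum] at h_one
  calc ∫⁻ x in A, ‖signField u (x + h) - signField u x‖ₑ
      ≤ ∫⁻ x in A, (‖signField u (x + h) - signField u (x + c 0 • latticeBasis 0)‖ₑ
          + ‖signField u (x + c 0 • latticeBasis 0) - signField u x‖ₑ) :=
        lintegral_mono fun x => by
          simpa only [edist_eq_enorm_sub] using edist_triangle (signField u (x + h))
            (signField u (x + c 0 • latticeBasis 0)) (signField u x)
    _ = (∫⁻ x in A, ‖signField u (x + h) - signField u (x + c 0 • latticeBasis 0)‖ₑ)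
          + ∫⁻ x in A, ‖signField u (x + c 0 • latticeBasis 0) - signField u x‖ₑ :=
        lintegral_add_left (((measurable_signField u).comp (measurable_add_const h)).sub
          ((measurable_signField u).comp (measurable_add_const _))).enorm _
    _ ≤ ENNReal.ofReal (2 * r) * (320 * energy u Ω)
          + ENNReal.ofReal (2 * r) * (320 * energy u Ω) := add_le_add h_one h_zero
    _ = ENNReal.ofReal r * (1280 * energy u Ω) := by
        rw [ENNReal.ofReal_mul zero_le_two, ENNReal.ofReal_ofNat]
        ring

end SignField

/-! ### Sequences of spin fields of bounded energy -/

section Sequence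

variable {Ω : Set Plane} {ε : ℕ → ℝ} {u : ∀ n, SpinField (ε n)} {E : ℝ≥0∞}

theorem exists_subseq_tendsto_signField (hΩ : IsOpen Ω) (hΩ_fin : volume Ω ≠ ⊤)
    (hε_pos : ∀ n, 0 < ε n) (hε : Tendsto ε atTop (𝓝 0)) (hE : E ≠ ⊤)
    (hu : ∀ n, energy (u n) Ω ≤ E) :
    ∃ s : ℕ → ℕ, StrictMono s ∧ ∃ χ : Plane → ℝ, MemLp χ 1 (volume.restrict Ω) ∧
      Tendsto (fun n => eLpNorm (signField (u (s n)) - χ) 1 (volume.restrict Ω)) atTop (𝓝 0) := by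
  refine exists_subseq_tendsto_of_translate (f := fun n => signField (u n)) hΩ.measurableSet hΩ_fin
    (fun n => measurable_signField (u n)) (fun n x => (norm_signField (u n) x).le)
    fun K hK hKΩ η hη => ?_
  obtain ⟨δ, hδ, hKδ⟩ := exists_pos_forall_closedBall_subset hK hΩ hKΩ
  have h_top : 1280 * E ≠ ⊤ := ENNReal.mul_ne_top (by simp) hE
  obtain ⟨ρ, hρ, hρη⟩ := ENNReal.exists_nnreal_pos_mul_lt h_top hη
  set r : ℝ := min (δ / 5) ρ
  have hr : 0 < r := lt_min (by positivity) hρ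
  have hrδ : 5 * r ≤ δ := by linarith [min_le_left (δ / 5) (ρ : ℝ)]
  have hB : openParallelogram r ⊆ Metric.closedBall 0 (2 * r) := fun h hh =>
    mem_closedBall_zero_iff.mpr (norm_le_of_mem_openParallelogram hh)
  refine ⟨openParallelogram r, (isOpen_openParallelogram r).measurableSet,
    ((isOpen_openParallelogram r).measure_pos _ (openParallelogram_nonempty hr)).ne',
    ((measure_mono hB).trans_lt measure_closedBall_lt_top).ne, fun x hx h hh => hKδ x hx ?_, ?_⟩
  · rw [mem_closedBall_iff_norm, add_sub_cancel_left]
    exact (norm_le_of_mem_openParallelogram hh).trans (by linarith)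
  · filter_upwards [hε.eventually_le_const hr] with n hn h hh
    calc ∫⁻ x in K, ‖signField (u n) (x + h) - signField (u n) x‖ₑ
        ≤ ENNReal.ofReal r * (1280 * energy (u n) Ω) :=
          lintegral_signField_add_sub_le (hε_pos n) hn (fun x hx =>
            (Metric.closedBall_subset_closedBall hrδ).trans (hKδ x hx)) hh
      _ ≤ ρ * (1280 * E) := by
          gcongr
          · exact ENNReal.ofReal_le_of_le_toReal (min_le_right _ _)
          · exact hu n
      _ ≤ η := hρη.le

theorem tendsto_eLpNorm_chirality_sub_signField (hΩ : IsOpen Ω) (hΩ_fin : volume Ω ≠ ⊤)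
    (hε_pos : ∀ n, 0 < ε n) (hε : Tendsto ε atTop (𝓝 0)) (hE : E ≠ ⊤)
    (hu : ∀ n, energy (u n) Ω ≤ E) :
    Tendsto (fun n => eLpNorm (chirality (u n) - signField (u n)) 1 (volume.restrict Ω))
      atTop (𝓝 0) := by
  simp only [eLpNorm_one_eq_lintegral_enorm, Pi.sub_apply]
  refine tendsto_setLIntegral_enorm_zero_of_isCompact hΩ.measurableSet hΩ_fin (C := 2) (by simp)
    (fun n x => ?_) fun K hK hKΩ => ?_
  · have h_le : ‖chirality (u n) x - signField (u n) x‖ ≤ 2 := by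
      linarith [norm_sub_le (chirality (u n) x) (signField (u n) x), norm_chirality_le_one (u n) x,
        norm_signField (u n) x]
    simpa only [ofReal_norm, ENNReal.ofReal_ofNat] using ENNReal.ofReal_le_ofReal h_le
  · obtain ⟨δ, hδ, hKδ⟩ := exists_pos_forall_closedBall_subset hK hΩ hKΩ
    have h_lim : Tendsto (fun n => 112 * ENNReal.ofReal (ε n) * E) atTop (𝓝 0) := by
      simpa using ENNReal.Tendsto.mul_const (ENNReal.Tendsto.const_mul
        (ENNReal.tendsto_ofReal hε) (.inr (by simp : (112 : ℝ≥0∞) ≠ ⊤))) (.inr hE)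
    refine tendsto_of_tendsto_of_tendsto_of_le_of_le' tendsto_const_nhds h_lim
      (.of_forall fun n => zero_le) ?_
    filter_upwards [hε.eventually_le_const (half_pos hδ)] with n hn
    refine (lintegral_chirality_sub_signField_le (hε_pos n) fun x hx =>
      (Metric.closedBall_subset_closedBall (by linarith)).trans (hKδ x hx)).trans ?_
    gcongr
    exact hu n

theorem totalVariation_lt_top_of_tendsto_signField (hΩ : IsOpen Ω)
    (hε_pos : ∀ n, 0 < ε n) (hε : Tendsto ε atTop (𝓝 0)) (hE : E ≠ ⊤)
    (hu : ∀ n, energy (u n) Ω ≤ E) {χ : Plane → ℝ} (hχ : IntegrableOn χ Ω)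
    (hlim : Tendsto (fun n => eLpNorm (signField (u n) - χ) 1 (volume.restrict Ω)) atTop (𝓝 0)) :
    totalVariation χ Ω < ⊤ := by
  have h_top : 320 * E ≠ ⊤ := ENNReal.mul_ne_top (by simp) hE
  refine totalVariation_lt_top hχ latticeBasis h_top fun i ψ hψ hψ_supp hψΩ B hψB =>
    enorm_setIntegral_mul_fderiv_le hΩ (fun n => locallyIntegrable_signField (u n)) hχ hlim hε_pos
      hε (fun K hK hKΩ => ?_) hψ hψ_supp hψΩ hψB
  obtain ⟨δ, hδ, hKδ⟩ := exists_pos_forall_closedBall_subset hK hΩ hKΩ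
  filter_upwards [hε.eventually_le_const (div_pos hδ three_pos)] with n hn
  have h_ball (x : Plane) (hx : x ∈ K) : Metric.closedBall (x + 0) (3 * ε n) ⊆ Ω := by
    rw [add_zero]
    exact (Metric.closedBall_subset_closedBall (by linarith)).trans (hKδ x hx)
  calc ∫⁻ x in K, ‖signField (u n) (x + ε n • latticeBasis i) - signField (u n) x‖ₑ
      ≤ 320 * ENNReal.ofReal (ε n) * energy (u n) Ω := by
        simpa only [zero_add, add_zero] using
          lintegral_signField_add_sub_le_of_le (hε_pos n) (hε_pos n).le le_rfl h_ball i
    _ ≤ 320 * ENNReal.ofReal (ε n) * E := by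
        gcongr
        exact hu n
    _ = ENNReal.ofReal (ε n) * (320 * E) := by ring

theorem memBVSign_of_tendsto_signField (hΩ : IsOpen Ω) (hε_pos : ∀ n, 0 < ε n)
    (hε : Tendsto ε atTop (𝓝 0)) (hE : E ≠ ⊤) (hu : ∀ n, energy (u n) Ω ≤ E) {χ : Plane → ℝ}
    (hχ : IntegrableOn χ Ω)
    (hlim : Tendsto (fun n => eLpNorm (signField (u n) - χ) 1 (volume.restrict Ω)) atTop (𝓝 0)) :
    MemBVSign χ Ω :=
  ⟨hχ, totalVariation_lt_top_of_tendsto_signField hΩ hε_pos hε hE hu hχ hlim,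
    ae_mem_of_tendsto_eLpNorm one_ne_zero (S := {-1, 1}) (Set.toFinite _).isClosed
      (fun n => (measurable_signField (u n)).aestronglyMeasurable)
      (fun n => ae_of_all _ (signField_mem (u n))) hχ.aestronglyMeasurable hlim⟩

theorem tendsto_eLpNorm_chirality_sub (hΩ : IsOpen Ω) (hΩ_fin : volume Ω ≠ ⊤)
    (hε_pos : ∀ n, 0 < ε n) (hε : Tendsto ε atTop (𝓝 0)) (hE : E ≠ ⊤)
    (hu : ∀ n, energy (u n) Ω ≤ E) {χ : Plane → ℝ}
    (hχ : AEStronglyMeasurable χ (volume.restrict Ω))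
    (hlim : Tendsto (fun n => eLpNorm (signField (u n) - χ) 1 (volume.restrict Ω)) atTop (𝓝 0)) :
    Tendsto (fun n => eLpNorm (chirality (u n) - χ) 1 (volume.restrict Ω)) atTop (𝓝 0) := by
  have h_sum := (tendsto_eLpNorm_chirality_sub_signField hΩ hΩ_fin hε_pos hε hE hu).add hlim
  rw [add_zero] at h_sum
  refine tendsto_of_tendsto_of_tendsto_of_le_of_le tendsto_const_nhds h_sum
    (fun n => zero_le) fun n => ?_
  have hσ : AEStronglyMeasurable (signField (u n)) (volume.restrict Ω) :=
    (measurable_signField (u n)).aestronglyMeasurable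
  simpa only [sub_add_sub_cancel] using eLpNorm_add_le
    ((aestronglyMeasurable_chirality (u n) (hε_pos n)).restrict.sub hσ) (hσ.sub hχ) le_rfl

end Sequence

end TriXY

end

open TriXY in
theorem proposition3p1_general {Ω : Set Plane} (hΩ : IsOpen Ω) (hΩ_fin : volume Ω ≠ ⊤)
    {ε : ℕ → ℝ} (hε_pos : ∀ n, 0 < ε n) (hε : Tendsto ε atTop (𝓝 0)) (u : ∀ n, SpinField (ε n))
    (hu : (⨆ n, energy (u n) Ω) < ⊤) :
    (∀ n, IntegrableOn (chirality (u n)) Ω) ∧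
    ∃ χ : Plane → ℝ, MemBVSign χ Ω ∧ ∃ s : ℕ → ℕ, StrictMono s ∧
      Tendsto (fun n => eLpNorm (fun x => chirality (u (s n)) x - χ x) 1 (volume.restrict Ω))
        atTop (𝓝 0) := by
  have hE (n : ℕ) : energy (u n) Ω ≤ ⨆ n, energy (u n) Ω := le_iSup (fun n => energy (u n) Ω) n
  refine ⟨fun n => integrableOn_chirality (u n) (hε_pos n) hΩ_fin, ?_⟩
  obtain ⟨s, hs, χ, hχ, h_sign⟩ :=
    exists_subseq_tendsto_signField hΩ hΩ_fin hε_pos hε hu.ne hE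
  have hεs_pos (n : ℕ) : 0 < ε (s n) := hε_pos (s n)
  have hεs : Tendsto (fun n => ε (s n)) atTop (𝓝 0) := hε.comp hs.tendsto_atTop
  have hEs (n : ℕ) : energy (u (s n)) Ω ≤ ⨆ n, energy (u n) Ω := hE (s n)
  have hχ_sign : MemBVSign χ Ω := memBVSign_of_tendsto_signField hΩ hεs_pos hεs hu.ne hEs
    (memLp_one_iff_integrable.mp hχ) h_sign
  exact ⟨χ, hχ_sign, s, hs, tendsto_eLpNorm_chirality_sub hΩ hΩ_fin hεs_pos hεs hu.ne hEs
    hχ.aestronglyMeasurable h_sign⟩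

theorem proposition3p1
    (Ω : Set TriXY.Plane) (hΩ_open : IsOpen Ω) (hΩ_bdd : Bornology.IsBounded Ω)
    (ε : ℕ → ℝ) (hε_pos : ∀ n, 0 < ε n) (hε : Tendsto ε atTop (𝓝 0))
    (u : ∀ n, TriXY.SpinField (ε n))
    (hu : (⨆ n, TriXY.energy (u n) Ω) < ⊤) :
    (∀ n, IntegrableOn (TriXY.chirality (u n)) Ω) ∧
    ∃ χ : TriXY.Plane → ℝ, TriXY.MemBVSign χ Ω ∧
      ∃ s : ℕ → ℕ, StrictMono s ∧
        Tendsto (fun n => eLpNorm (fun x => TriXY.chirality (u (s n)) x - χ x) 1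
          (volume.restrict Ω)) atTop (𝓝 0) :=
  proposition3p1_general hΩ_open hΩ_bdd.measure_lt_top.ne hε_pos hε u hu
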